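/- Let $(X,d)$ be a metric space with bounded geometry, i.e. for every $R\ge 0$ one has $\sup_{x\in X}\#\{y\in X: d(x,y)\le R\}<\infty$. Let $E$ be a complex Banach space and $p\in\{0\}\cup[1,\infty]$. Write $\ell^p_E(X)=\ell^p(X;E)$ for $p\in[1,\infty]$ and $\ell^0_E(X)=c_0(X;E)$ (with the sup-norm). Let $C_b(X)$ (the bounded functions $X\to\mathbb C$, all of them being continuous) and its subalgebra $C_0(X)$ (functions vanishing at infinity) act on $\ell^p_E(X)$ by pointwise multiplication. If $p\in(1,\infty)$, assume in addition that $X$ has Property A: for some (equivalently, every) $s\in[1,\infty)$ and for all $r,\varepsilon>0$ there are functions $\phi_i:X\to[0,1]$, $i\in I$, whose supports have uniformly bounded diameter and finite multiplicity (there is $M$ such that each point of $X$ lies in at most $M$ of the supports), with $\sum_i\phi_i(x)^s=1$ for every $x\in X$ and $\sum_i|\phi_i(x)-\phi_i(y)|^s<\varepsilon^s$ whenever $d(x,y)\le r$. Let $B\subseteq\mathfrak B(\ell^p_E(X))$ be a norm-closed, not necessarily unital, subalgebra of the bounded operators such that $C_b(X)\,B\,C_b(X)=B$ and such that $B$ is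 closed under block cutdowns: for $a\in B$ and every family $(e_j)_{j\in J}$ in $C_b(X)$ of functions with values in $[0,1]$ and pairwise disjoint supports, $\sum_{j\in J}e_jae_j\in B$, where the sum converges in the strong operator topology if $p\neq\infty$, and, if $p=\infty$, in the sense that for every $v\in\ell^\infty_E(X)$ it converges at each point of $X$ when applied to $v$. An operator $a$ has finite propagation if there is $R\ge0$ with $faf'=0$ for all $f,f'\in C_b(X)$ with $d(\mathrm{supp} f,\mathrm{supp} f')>R$. Let $\mathrm{Roe}(X,B)$ be the norm-closure of the set of operators in $B$ of finite propagation, and let $\mathcal K(X,B)$ be the norm-closure of $C_0(X)\,B\,C_0(X)$. Then: if $a\in\mathrm{Roe}(X,B)$ and $b\in B$ satisfy $\mathrm{Id}-ab\in\mathcal K(X,B)$ and $\mathrm{Id}-ba\in\mathcal K(X,B)$, then $b\in\mathrm{Roe}(X,B)$. In particular, if $B$ is closed under taking inverses (whenever $a\in B$ is invertible in $\mathfrak B(\ell^p_E(X))$, then $a^{-1}\in B$), then so is $\mathrm{Roe}(X,B)$. -/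

import Mathlib

open scoped ENNReal Topology

universe u v

noncomputable section

namespace RoeLike

/-! ## Metric notions -/

/-- Bounded geometry: for every `R`, the cardinalities of the closed balls of radius `R` are
uniformly bounded by a finite number. -/
def BoundedGeometry (X : Type u) [MetricSpace X] : Prop :=
  ∀ R : ℝ, ∃ N : ℕ, ∀ x : X, (Metric.closedBall x R).encard ≤ N

/-- The distance `inf {d(x, y) | x ∈ S, y ∈ T}` between two sets (`∞` if one of them is empty). -/
def setDist {X : Type u} [MetricSpace X] (S T : Set X) : ℝ≥0∞ :=
  ⨅ x ∈ S, ⨅ y ∈ T, edist x y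

/-- A metric `p`-partition of unity on `X`: functions `φ i : X → [0,1]` whose (closed) supports are
uniformly bounded and have finite multiplicity, with `∑ i, φ i x ^ p = 1` for every `x`. -/
structure IsMetricPartition {X : Type u} [MetricSpace X] (p : ℝ) {I : Type u}
    (φ : I → X → ℝ) : Prop where
  mem_Icc : ∀ i x, φ i x ∈ Set.Icc (0 : ℝ) 1
  uniformly_bounded : ∃ D : ℝ, ∀ i, ∀ x ∈ tsupport (φ i), ∀ y ∈ tsupport (φ i), dist x y ≤ D
  finite_multiplicity : ∃ M : ℕ, ∀ x, {i | x ∈ tsupport (φ i)}.encard ≤ M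
  hasSum_one : ∀ x, HasSum (fun i => φ i x ^ p) 1

/-- `(r, ε)`-variation of a metric `p`-partition of unity. The sums have only finitely many nonzero
terms, by finite multiplicity. -/
def HasVariation {X : Type u} [MetricSpace X] (p r ε : ℝ) {I : Type u} (φ : I → X → ℝ) : Prop :=
  ∀ x y : X, dist x y ≤ r → ∑' i, |φ i x - φ i y| ^ p < ε ^ p

/-- Property A, through partitions of unity: for some exponent `p ∈ [1,∞)` and all `r, ε > 0` there
is a metric `p`-partition of unity with `(r, ε)`-variation. The property at one exponent is well
known to be equivalent to the property at any other; "some exponent" is formally the weakest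
form. -/
def PropertyA (X : Type u) [MetricSpace X] : Prop :=
  ∃ p : ℝ, 1 ≤ p ∧ ∀ r > 0, ∀ ε > 0, ∃ (I : Type u) (φ : I → X → ℝ),
    IsMetricPartition p φ ∧ HasVariation p r ε φ

/-! ## The Banach spaces `ℓ^p_E(X)`, `p ∈ {0} ∪ [1,∞]` -/

/-- The exponent of the norm of `ℓ^p_E(X)`: the sup-norm is used for `p = 0`. -/
def normExp (p : ℝ≥0∞) : ℝ≥0∞ := if p = 0 then ∞ else p

instance normExp_fact (p : ℝ≥0∞) [hp : Fact (p = 0 ∨ 1 ≤ p)] : Fact (1 ≤ normExp p) := by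
  refine ⟨?_⟩
  unfold normExp
  split_ifs with h
  · exact le_top
  · exact hp.out.resolve_left h

theorem normExp_ne_zero (p : ℝ≥0∞) : normExp p ≠ 0 := by
  unfold normExp
  split_ifs with h
  · exact ENNReal.top_ne_zero
  · exact h

/-- `ℓ^p_E(X)`: for `p ∈ [1,∞]` all `p`-summable (bounded, if `p = ∞`) functions `X → E`; for `p = 0`
the space `c₀(X; E)` of bounded functions vanishing at infinity, with the sup-norm. In a space of
bounded geometry the topology is discrete and the compact sets are the finite sets, so that vanishing
at infinity is convergence to zero along the cofinite filter. -/
def ellSub (X : Type u) (E : Type v) [NormedAddCommGroup E] [NormedSpace ℂ E] (p : ℝ≥0∞) :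
    Submodule ℂ (lp (fun _ : X => E) (normExp p)) where
  carrier := {v | p = 0 → Filter.Tendsto (fun x => v x) Filter.cofinite (𝓝 0)}
  zero_mem' := fun _ => tendsto_const_nhds
  add_mem' := fun {v w} hv hw h => by simpa using (hv h).add (hw h)
  smul_mem' := fun c v hv h => by simpa using (hv h).const_smul c

/-- `ℓ^p_E(X)` as a normed space; the norm is the one inherited from `lp`. -/
abbrev Ell (X : Type u) (E : Type v) [NormedAddCommGroup E] [NormedSpace ℂ E] (p : ℝ≥0∞) : Type _ :=
  ellSub X E p

/-- The value at `x : X` of an element of `ℓ^p_E(X)`. -/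
def Ell.val {X : Type u} {E : Type v} [NormedAddCommGroup E] [NormedSpace ℂ E] {p : ℝ≥0∞}
    (v : Ell X E p) (x : X) : E :=
  (v : lp (fun _ : X => E) (normExp p)) x

/-- The bounded linear operators on `ℓ^p_E(X)`. -/
abbrev BOp (X : Type u) (E : Type v) [NormedAddCommGroup E] [NormedSpace ℂ E] (p : ℝ≥0∞)
    [Fact (p = 0 ∨ 1 ≤ p)] : Type _ :=
  Ell X E p →L[ℂ] Ell X E p

section Operators

variable {X : Type u} [MetricSpace X] {E : Type v} [NormedAddCommGroup E] [NormedSpace ℂ E]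
  {p : ℝ≥0∞}

open scoped BoundedContinuousFunction

theorem norm_smul_apply_le (f : X →ᵇ ℂ) (v : Ell X E p) (x : X) :
    ‖f x • v.val x‖ ≤ ‖((‖f‖ : ℂ) • (v : lp (fun _ : X => E) (normExp p))) x‖ := by
  have h : ‖((‖f‖ : ℂ) • (v : lp (fun _ : X => E) (normExp p))) x‖ = ‖f‖ * ‖v.val x‖ := by
    rw [lp.coeFn_smul, Pi.smul_apply, norm_smul]
    simp [Ell.val]
  rw [h, norm_smul]
  exact mul_le_mul_of_nonneg_right (f.norm_coe_le_norm x) (norm_nonneg _)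

/-- The pointwise product of `f ∈ C_b(X)` and `v ∈ ℓ^p_E(X)`. -/
def mulVec (f : X →ᵇ ℂ) (v : Ell X E p) : Ell X E p :=
  ⟨⟨fun x => f x • v.val x,
    (lp.memℓp ((‖f‖ : ℂ) • (v : lp (fun _ : X => E) (normExp p)))).mono'
      (norm_smul_apply_le f v)⟩, fun h => by
    have h0 : Filter.Tendsto (fun x => ‖f‖ * ‖v.val x‖) Filter.cofinite (𝓝 0) := by
      simpa [Ell.val] using (v.2 h).norm.const_mul ‖f‖
    refine squeeze_zero_norm (fun x => ?_) h0
    change ‖f x • v.val x‖ ≤ _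
    rw [norm_smul]
    exact mul_le_mul_of_nonneg_right (f.norm_coe_le_norm x) (norm_nonneg _)⟩

variable [Fact (p = 0 ∨ 1 ≤ p)]

/-- The representation of `C_b(X)` on `ℓ^p_E(X)` by pointwise multiplication. -/
def mulOp (f : X →ᵇ ℂ) : BOp X E p :=
  LinearMap.mkContinuous
    { toFun := mulVec f
      map_add' := fun v w => by
        apply Subtype.ext; apply lp.ext; funext x
        exact smul_add (f x) (v.val x) (w.val x)
      map_smul' := fun c v => by
        apply Subtype.ext; apply lp.ext; funext x
        exact smul_comm (f x) c (v.val x) }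
    ‖f‖ (fun v => by
      have h : ‖(mulVec f v : lp (fun _ : X => E) (normExp p))‖ ≤
          ‖(‖f‖ : ℂ) • (v : lp (fun _ : X => E) (normExp p))‖ :=
        lp.norm_mono (normExp_ne_zero p) (norm_smul_apply_le f v)
      rw [norm_smul] at h
      simpa using h)

theorem mulOp_apply_val (f : X →ᵇ ℂ) (v : Ell X E p) (x : X) :
    (mulOp f v).val x = f x • v.val x := rfl

/-! ## Propagation and block cutdowns -/

/-- `a` has propagation at most `R`. -/
def PropagationLE (a : BOp X E p) (R : ℝ) : Prop :=
  ∀ f f' : X →ᵇ ℂ, ENNReal.ofReal R < setDist (tsupport f) (tsupport f') →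
    mulOp f * a * mulOp f' = 0

/-- `a` has finite propagation. -/
def FinitePropagation (a : BOp X E p) : Prop :=
  ∃ R : ℝ, 0 ≤ R ∧ PropagationLE a R

/-- A family of positive contractions in `C_b(X)` with pairwise disjoint supports. -/
structure IsCutdownFamily {J : Type u} (e : J → X →ᵇ ℂ) : Prop where
  positive_contraction : ∀ j x, ∃ t ∈ Set.Icc (0 : ℝ) 1, e j x = (t : ℂ)
  disjoint_supports : Pairwise fun i j => Disjoint (tsupport (e i)) (tsupport (e j))

/-- `T` is the block cutdown `∑ j, e j * a * e j` of `a`: the sum converges to `T` strongly if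
`p ∈ {0} ∪ [1,∞)`, and pointwise strongly if `p = ∞`. -/
def IsBlockCutdown {J : Type u} (e : J → X →ᵇ ℂ) (a T : BOp X E p) : Prop :=
  if p = ∞ then
    ∀ (v : Ell X E p) (x : X),
      HasSum (fun j => ((mulOp (e j) * a * mulOp (e j) : BOp X E p) v).val x) ((T v).val x)
  else
    ∀ v : Ell X E p, HasSum (fun j => (mulOp (e j) * a * mulOp (e j) : BOp X E p) v) (T v)

/-- A set `B` of operators is closed under block cutdowns. -/
def ClosedUnderBlockCutdowns (B : Set (BOp X E p)) : Prop :=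
  ∀ a ∈ B, ∀ (J : Type u) (e : J → X →ᵇ ℂ), IsCutdownFamily e →
    ∀ T, IsBlockCutdown e a T → T ∈ B

/-- The set `C_b(X) B C_b(X)`. -/
def cbCb (B : Set (BOp X E p)) : Set (BOp X E p) :=
  {T | ∃ f g : X →ᵇ ℂ, ∃ b ∈ B, T = mulOp f * b * mulOp g}

/-- The set `C₀(X) B C₀(X)`. -/
def c0C0 (B : Set (BOp X E p)) : Set (BOp X E p) :=
  {T | ∃ f g : ZeroAtInftyContinuousMap X ℂ, ∃ b ∈ B, T = mulOp f.toBCF * b * mulOp g.toBCF}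

/-- `Roe(X, B)`: the norm-closure of the operators in `B` of finite propagation. -/
def roe (B : Set (BOp X E p)) : Set (BOp X E p) :=
  closure {b | b ∈ B ∧ FinitePropagation b}

/-- `𝒦(X, B)`: the norm-closure of `C₀(X) B C₀(X)`. -/
def compactPart (B : Set (BOp X E p)) : Set (BOp X E p) :=
  closure (c0C0 B)

/-- A set of bounded operators is closed under taking inverses: the inverse of any of its elements
that is invertible as a bounded operator belongs to it again. -/
def InverseClosed (S : Set (BOp X E p)) : Prop :=
  ∀ a : (BOp X E p)ˣ,
    (a : BOp X E p) ∈ S → ((a⁻¹ : (BOp X E p)ˣ) : BOp X E p) ∈ S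

end Operators

end RoeLike

end

/-!
An operator `a` belongs to `Roe(X, B)` exactly when it belongs to `B` and its commutators `[a, f]`
with functions `f : X → [0,1]` of small Lipschitz constant are uniformly small. This description
is stable, within `B`, under inversion modulo `𝒦(X, B)`, and that is the whole point of the
argument.

*From propagation to commutators.* If `a` has propagation at most `R`, replace `f` by a step
function whose steps are wider than `R`. The commutator is then a small multiple of a difference
of block diagonal compressions `∑ i, e i a g i` of `a`. These have norm at most `‖a‖`, being
averages, over the signs, of products `(∑ i, ± e i) a (∑ j, ± g j)` (`norm_sum_blocks_le`). This
gives `FinitePropagation.almostCommutes`, which extends to the closure by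
`almostCommutes_of_mem_roe`.

*Inversion.* For every scalar `t`, `[b, f] = b [f, a] b + b (f - t) (1 - a b) - (1 - b a) (f - t)
b`. With `t` a value of `f`, the function `f - t` is small on any given finite set once the
Lipschitz constant of `f` is small, hence it is small against a given element of `𝒦(X, B)`; so `b`
almost commutes with slowly varying functions as soon as `a` does
(`AlmostCommutes.of_inverse_mod_compact`).

*From commutators to propagation.* Testing against functions separating two distant sets shows
that `b` is quasi-local (`AlmostCommutes.quasiLocal`). A quasi-local `b ∈ B` is approximated by
band operators `T = ∑ i, α i b β i`, where the supports of `α i` and `β i` lie in uniformly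
bounded sets of finite multiplicity. Such a `T` is in `B`: a greedy colouring splits the index set
into finitely many classes with disjoint supports, and each class is a block cutdown of `b` up to
multiplication by functions (`exists_hasSum_band`). For `p ∈ {0, ∞}` one truncates the rows of
`b`, for `p = 1` its columns (`QuasiLocal.mem_roe_of_sup`, `QuasiLocal.mem_roe_of_eq_one`).

For `1 < p < ∞` neither works, and Property A enters twice (`QuasiLocal.mem_roe_of_propertyA`). It
yields partitions of unity `μ` of small `ℓ¹`-variation (`PropertyA.exists_isUnitPartition`). With
`β i = μ i ^ (1 / p)` and `α i = μ i ^ (1 - 1 / p)`, Hölder's inequality shows that `b - T` is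
small on vectors supported in a ball (`IsHolderPair.enorm_sub_apply_rpow_le`) and that `T`
inherits the quasi-locality estimates of `b` (`IsHolderPair.norm_compression_le`). It remains to
see that the norm of such an operator is detected on vectors of small support
(`IsUnitPartition.norm_le_of_localized`). A second partition of unity provides Følner sets for
finitely supported measures, hence metric sparsification: a vector is, up to a small part of its
norm, supported on uniformly bounded pieces which are far apart from each other
(`IsUnitPartition.exists_sparse`). On such a vector, quasi-locality makes the operator block
diagonal up to a small error, which does not depend on the number of blocks because the
off-diagonal part is again an average over signs (`norm_diagonal_sub_le`).
-/

noncomputable section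

namespace RoeLike

open scoped BoundedContinuousFunction

/-! ### The spaces `ℓ^p_E(X)` -/

section Basics

variable {X : Type u} {E : Type v} [NormedAddCommGroup E] [NormedSpace ℂ E] {p : ℝ≥0∞}

@[ext] theorem Ell.ext {v w : Ell X E p} (h : ∀ x, v.val x = w.val x) : v = w :=
  Subtype.ext (lp.ext (funext h))

@[simp] theorem Ell.val_zero (x : X) : (0 : Ell X E p).val x = 0 := rfl

@[simp] theorem Ell.val_add (v w : Ell X E p) (x : X) : (v + w).val x = v.val x + w.val x := rfl

@[simp] theorem Ell.val_sub (v w : Ell X E p) (x : X) : (v - w).val x = v.val x - w.val x := rfl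

@[simp] theorem Ell.val_smul (c : ℂ) (v : Ell X E p) (x : X) : (c • v).val x = c • v.val x := rfl

variable [Fact (p = 0 ∨ 1 ≤ p)]

theorem Ell.norm_val_le (v : Ell X E p) (x : X) : ‖v.val x‖ ≤ ‖v‖ :=
  lp.norm_apply_le_norm (normExp_ne_zero p) (v : lp (fun _ : X => E) (normExp p)) x

/-- Evaluation at a point, as a continuous linear map. -/
def evalCLM (x : X) : Ell X E p →L[ℂ] E :=
  LinearMap.mkContinuous
    { toFun := fun v => v.val x
      map_add' := fun _ _ => rfl
      map_smul' := fun _ _ => rfl } 1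
    (fun v => by rw [one_mul]; exact v.norm_val_le x)

@[simp] theorem Ell.val_sum {ι : Type*} (s : Finset ι) (v : ι → Ell X E p) (x : X) :
    (∑ i ∈ s, v i).val x = ∑ i ∈ s, (v i).val x :=
  map_sum (evalCLM (E := E) (p := p) x) v s

/-- The normed ring structure of `BOp X E p`, as a shortcut for instance search. -/
@[reducible] def bopNormedRing : NormedRing (BOp X E p) := ContinuousLinearMap.toNormedRing

/-- The normed algebra structure of `BOp X E p`, as a shortcut for instance search. -/
@[reducible] def bopNormedAlgebra : NormedAlgebra ℂ (BOp X E p) :=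
  ContinuousLinearMap.toNormedAlgebra

end Basics

attribute [local instance] bopNormedRing bopNormedAlgebra

/-! ### Multiplication operators -/

section Mul

variable {X : Type u} [MetricSpace X] {E : Type v} [NormedAddCommGroup E] [NormedSpace ℂ E]
  {p : ℝ≥0∞} [Fact (p = 0 ∨ 1 ≤ p)]

theorem mulOp_mul (f g : X →ᵇ ℂ) : (mulOp (f * g) : BOp X E p) = mulOp f * mulOp g := by
  ext v x
  exact mul_smul (f x) (g x) (v.val x)

theorem mulOp_add (f g : X →ᵇ ℂ) : (mulOp (f + g) : BOp X E p) = mulOp f + mulOp g := by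
  ext v x
  exact add_smul (f x) (g x) (v.val x)

theorem mulOp_sub (f g : X →ᵇ ℂ) : (mulOp (f - g) : BOp X E p) = mulOp f - mulOp g := by
  ext v x
  exact sub_smul (f x) (g x) (v.val x)

theorem mulOp_smul (c : ℂ) (f : X →ᵇ ℂ) : (mulOp (c • f) : BOp X E p) = c • mulOp f := by
  ext v x
  exact smul_assoc c (f x) (v.val x)

@[simp] theorem mulOp_one : (mulOp (1 : X →ᵇ ℂ) : BOp X E p) = 1 := by
  ext v x
  exact one_smul ℂ (v.val x)

@[simp] theorem mulOp_zero : (mulOp (0 : X →ᵇ ℂ) : BOp X E p) = 0 := by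
  ext v x
  exact zero_smul ℂ (v.val x)

theorem mulOp_sum {ι : Type*} (s : Finset ι) (f : ι → X →ᵇ ℂ) :
    (mulOp (∑ i ∈ s, f i) : BOp X E p) = ∑ i ∈ s, mulOp (f i) := by
  classical
  induction s using Finset.induction_on with
  | empty => simp
  | insert a s ha ih => rw [Finset.sum_insert ha, Finset.sum_insert ha, mulOp_add, ih]

theorem mulOp_comm (f g : X →ᵇ ℂ) : (mulOp f * mulOp g : BOp X E p) = mulOp g * mulOp f := by
  rw [← mulOp_mul, ← mulOp_mul, mul_comm]

theorem norm_mulOp_le (f : X →ᵇ ℂ) : ‖(mulOp f : BOp X E p)‖ ≤ ‖f‖ :=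
  LinearMap.mkContinuous_norm_le _ (norm_nonneg _) _

theorem norm_mulOp_le_of_forall {f : X →ᵇ ℂ} {C : ℝ} (hC : 0 ≤ C) (h : ∀ x, ‖f x‖ ≤ C) :
    ‖(mulOp f : BOp X E p)‖ ≤ C :=
  (norm_mulOp_le f).trans ((BoundedContinuousFunction.norm_le hC).2 h)

theorem norm_mulOp_mul_le {f : X →ᵇ ℂ} (h : ∀ x, ‖f x‖ ≤ 1) (a : BOp X E p) :
    ‖mulOp f * a‖ ≤ ‖a‖ :=
  (norm_mul_le (mulOp f) a).trans
    (mul_le_of_le_one_left (norm_nonneg a) (norm_mulOp_le_of_forall zero_le_one h))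

theorem norm_mul_mulOp_le {f : X →ᵇ ℂ} (h : ∀ x, ‖f x‖ ≤ 1) (a : BOp X E p) :
    ‖a * mulOp f‖ ≤ ‖a‖ :=
  (norm_mul_le a (mulOp f)).trans
    (mul_le_of_le_one_right (norm_nonneg a) (norm_mulOp_le_of_forall zero_le_one h))

theorem norm_mulOp_mul_mulOp_le {f g : X →ᵇ ℂ} (hf : ∀ x, ‖f x‖ ≤ 1) (hg : ∀ x, ‖g x‖ ≤ 1)
    (a : BOp X E p) : ‖mulOp f * a * mulOp g‖ ≤ ‖a‖ :=
  (norm_mul_mulOp_le hg _).trans (norm_mulOp_mul_le hf a)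

theorem norm_mulOp_apply_le {f : X →ᵇ ℂ} (h : ∀ x, ‖f x‖ ≤ 1) (v : Ell X E p) :
    ‖mulOp f v‖ ≤ ‖v‖ :=
  ((mulOp f : BOp X E p).le_opNorm v).trans
    (mul_le_of_le_one_left (norm_nonneg _) (norm_mulOp_le_of_forall zero_le_one h))

end Mul

/-- A space of bounded geometry is discrete: its balls are finite. -/
theorem BoundedGeometry.discreteTopology {X : Type u} [MetricSpace X] (hX : BoundedGeometry X) :
    DiscreteTopology X := by
  refine discreteTopology_iff_isOpen_singleton.2 fun x => ?_
  obtain ⟨N, hN⟩ := hX 1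
  have hfin : (Metric.closedBall x 1).Finite := Set.finite_of_encard_le_coe (hN x)
  have h1 : IsOpen (Metric.ball x 1 \ (Metric.closedBall x 1 \ {x})) :=
    Metric.isOpen_ball.sdiff (hfin.subset Set.sdiff_subset).isClosed
  convert h1 using 1
  ext y
  simp only [Set.mem_singleton_iff, Set.mem_sdiff, Metric.mem_ball, Metric.mem_closedBall, not_and,
    not_not]
  constructor
  · rintro rfl
    simp
  · rintro ⟨h, h'⟩
    exact h' h.le

theorem BoundedGeometry.finite_closedBall {X : Type u} [MetricSpace X] (hX : BoundedGeometry X)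
    (x : X) (R : ℝ) : (Metric.closedBall x R).Finite := by
  obtain ⟨N, hN⟩ := hX R
  exact Set.finite_of_encard_le_coe (hN x)

/-! ### Indicator functions on discrete spaces -/

section Discrete

variable {X : Type u} [MetricSpace X] [DiscreteTopology X]

/-- A function on a discrete space of modulus at most one, as an element of `C_b(X)`. -/
def unitBCF (f : X → ℂ) (hf : ∀ x, ‖f x‖ ≤ 1) : X →ᵇ ℂ :=
  BoundedContinuousFunction.ofNormedAddCommGroupDiscrete f 1 hf

@[simp] theorem unitBCF_apply (f : X → ℂ) (hf : ∀ x, ‖f x‖ ≤ 1) (x : X) : unitBCF f hf x = f x :=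
  rfl

open Classical in
/-- The indicator function of a subset of a discrete space, as an element of `C_b(X)`. -/
def ind (S : Set X) : X →ᵇ ℂ :=
  unitBCF (fun x => if x ∈ S then 1 else 0) (fun x => by split_ifs <;> simp)

theorem ind_of_mem {S : Set X} {x : X} (h : x ∈ S) : ind S x = 1 := if_pos h

theorem ind_of_notMem {S : Set X} {x : X} (h : x ∉ S) : ind S x = 0 := if_neg h

theorem norm_ind_le (S : Set X) (x : X) : ‖ind S x‖ ≤ 1 := by
  by_cases h : x ∈ S
  · simp [ind_of_mem h]
  · simp [ind_of_notMem h]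

theorem tsupport_eq_support (f : X → ℂ) : tsupport f = Function.support f :=
  (isClosed_discrete _).closure_eq

theorem tsupport_ind (S : Set X) : tsupport (ind S) = S := by
  rw [tsupport_eq_support]
  ext x
  by_cases h : x ∈ S
  · simp [h, ind_of_mem h]
  · simp [h, ind_of_notMem h]

theorem mul_ind_eq_self {f : X →ᵇ ℂ} {S : Set X} (h : ∀ x, x ∉ S → f x = 0) : f * ind S = f := by
  ext x
  by_cases hx : x ∈ S
  · simp [ind_of_mem hx]
  · simp [ind_of_notMem hx, h x hx]

theorem one_sub_ind (S : Set X) : 1 - ind S = ind Sᶜ := by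
  ext x
  by_cases hx : x ∈ S
  · simp [ind_of_mem hx, ind_of_notMem (Set.notMem_compl_iff.2 hx)]
  · simp [ind_of_notMem hx, ind_of_mem (Set.mem_compl hx)]

variable {E : Type v} [NormedAddCommGroup E] [NormedSpace ℂ E] {p : ℝ≥0∞} [Fact (p = 0 ∨ 1 ≤ p)]

theorem mulOp_ind_val_of_mem {S : Set X} {x : X} (h : x ∈ S) (v : Ell X E p) :
    (mulOp (ind S) v).val x = v.val x := by
  rw [mulOp_apply_val, ind_of_mem h, one_smul]

theorem mulOp_ind_val_of_notMem {S : Set X} {x : X} (h : x ∉ S) (v : Ell X E p) :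
    (mulOp (ind S) v).val x = 0 := by
  rw [mulOp_apply_val, ind_of_notMem h, zero_smul]

/-- An operator of propagation at most `R` has no matrix coefficients between sets whose distance
exceeds `R`. -/
theorem PropagationLE.ind_mul_ind {a : BOp X E p} {R : ℝ} (ha : PropagationLE a R) (hR : 0 ≤ R)
    {S T : Set X} (h : ∀ x ∈ S, ∀ y ∈ T, R + 1 ≤ dist x y) :
    mulOp (ind S) * a * mulOp (ind T) = 0 := by
  refine ha _ _ ?_
  rw [tsupport_ind, tsupport_ind]
  refine lt_of_lt_of_le ((ENNReal.ofReal_lt_ofReal_iff (by linarith)).2 (lt_add_one R)) ?_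
  refine le_iInf₂ fun x hx => le_iInf₂ fun y hy => ?_
  rw [edist_dist]
  exact ENNReal.ofReal_le_ofReal (h x hx y hy)

omit [DiscreteTopology X] in
theorem lt_dist_of_lt_setDist {S T : Set X} {R : ℝ} (h : ENNReal.ofReal R < setDist S T) {x y : X}
    (hx : x ∈ S) (hy : y ∈ T) : R < dist x y := by
  have h1 : setDist S T ≤ edist x y := iInf₂_le_of_le x hx (iInf₂_le y hy)
  by_contra hc
  rw [not_lt] at hc
  have := h.trans_le (h1.trans_eq (edist_dist x y))
  exact absurd this (not_lt.2 (ENNReal.ofReal_le_ofReal hc))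

end Discrete

/-! ### Averaging over signs -/

section Averaging

open Finset in
/-- The sum over all sign choices of a product of two distinct signs vanishes. -/
theorem sum_sign_mul_sign {ι : Type*} [Fintype ι] [DecidableEq ι] (i j : ι) :
    ∑ σ : ι → Bool, ((if σ i then 1 else -1) * (if σ j then 1 else -1) : ℂ) =
      if i = j then (2 : ℂ) ^ Fintype.card ι else 0 := by
  split_ifs with h
  · subst h
    have : ∀ σ : ι → Bool, ((if σ i then 1 else -1) * (if σ i then 1 else -1) : ℂ) = 1 := by
      intro σ; split_ifs <;> simp
    simp [this]
  · refine Finset.sum_involution (fun σ _ => Function.update σ i (!σ i)) ?_ ?_ ?_ ?_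
    · intro σ _
      rw [Function.update_self, Function.update_of_ne (Ne.symm h)]
      cases σ i <;> cases σ j <;> simp
    · intro σ _ _ h'
      have := congrFun h' i
      simp at this
    · simp
    · intro σ _
      simp

/-- Averaging over signs extracts the diagonal terms of a double sum. -/
theorem sum_sign_mul_mul {ι A : Type*} [Fintype ι] [DecidableEq ι] [Ring A] [Algebra ℂ A]
    (x y : ι → A) (a : A) :
    ∑ σ : ι → Bool, (∑ i, (if σ i then 1 else -1 : ℂ) • x i) * a *
      (∑ j, (if σ j then 1 else -1 : ℂ) • y j) =
      (2 : ℂ) ^ Fintype.card ι • ∑ i, x i * a * y i := by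
  have h : ∀ σ : ι → Bool, (∑ i, (if σ i then 1 else -1 : ℂ) • x i) * a *
      (∑ j, (if σ j then 1 else -1 : ℂ) • y j) =
      ∑ i, ∑ j, ((if σ i then 1 else -1) * (if σ j then 1 else -1) : ℂ) • (x i * a * y j) := by
    intro σ
    rw [Finset.sum_mul, Finset.sum_mul]
    refine Finset.sum_congr rfl fun i _ => ?_
    rw [Finset.mul_sum]
    refine Finset.sum_congr rfl fun j _ => ?_
    rw [smul_mul_assoc, smul_mul_assoc, mul_smul_comm, smul_smul]
  simp_rw [h]
  rw [Finset.sum_comm]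
  simp_rw [Finset.sum_comm (s := (Finset.univ : Finset (ι → Bool))), ← Finset.sum_smul,
    sum_sign_mul_sign]
  simp [Finset.smul_sum, ite_smul]

/-- To bound `∑ i, x i * a * y i - c`, it suffices to bound `(∑ i, ± x i) * a * (∑ j, ± y j) - c` for every
choice of signs. -/
theorem norm_sum_mul_mul_sub_le {ι A : Type*} [Fintype ι] [DecidableEq ι] [NormedRing A]
    [NormedAlgebra ℂ A] (x y : ι → A) (a c : A) {C : ℝ}
    (h : ∀ σ : ι → Bool, ‖(∑ i, (if σ i then 1 else -1 : ℂ) • x i) * a *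
      (∑ j, (if σ j then 1 else -1 : ℂ) • y j) - c‖ ≤ C) :
    ‖∑ i, x i * a * y i - c‖ ≤ C := by
  have h1 : (2 : ℂ) ^ Fintype.card ι • (∑ i, x i * a * y i - c) =
      ∑ σ : ι → Bool, ((∑ i, (if σ i then 1 else -1 : ℂ) • x i) * a *
        (∑ j, (if σ j then 1 else -1 : ℂ) • y j) - c) := by
    rw [Finset.sum_sub_distrib, sum_sign_mul_mul, smul_sub]
    simp [← Nat.cast_smul_eq_nsmul ℂ]
  have h2 : ‖(2 : ℂ) ^ Fintype.card ι • (∑ i, x i * a * y i - c)‖ ≤ 2 ^ Fintype.card ι * C := by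
    rw [h1]
    refine (norm_sum_le_of_le _ fun σ _ => h σ).trans_eq ?_
    simp
  rw [norm_smul, norm_pow] at h2
  simpa using h2

end Averaging

/-! ### Block diagonal compressions -/

section Blocks

variable {X : Type u} [MetricSpace X] {E : Type v} [NormedAddCommGroup E] [NormedSpace ℂ E]
  {p : ℝ≥0∞} [Fact (p = 0 ∨ 1 ≤ p)]

theorem norm_sum_sign_smul_le_one {ι : Type*} [Fintype ι] {e : ι → X →ᵇ ℂ}
    (he : ∀ i x, ‖e i x‖ ≤ 1) (hd : Pairwise fun i j => ∀ x, e i x = 0 ∨ e j x = 0)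
    (σ : ι → Bool) (x : X) : ‖(∑ i, (if σ i then 1 else -1 : ℂ) • e i) x‖ ≤ 1 := by
  classical
  rw [BoundedContinuousFunction.coe_sum, Finset.sum_apply]
  by_cases h : ∃ i, e i x ≠ 0
  · obtain ⟨i, hi⟩ := h
    rw [Finset.sum_eq_single i]
    · have := he i x
      cases σ i <;> simpa using this
    · intro j _ hj
      rw [BoundedContinuousFunction.smul_apply, (hd hj x).resolve_right hi, smul_zero]
    · simp
  · push Not at h
    rw [Finset.sum_eq_zero fun i _ => by rw [BoundedContinuousFunction.smul_apply, h i, smul_zero]]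
    simp

theorem sum_smul_mulOp {ι : Type*} [Fintype ι] (c : ι → ℂ) (e : ι → X →ᵇ ℂ) :
    (∑ i, c i • mulOp (e i) : BOp X E p) = mulOp (∑ i, c i • e i) := by
  rw [mulOp_sum]
  exact Finset.sum_congr rfl fun i _ => (mulOp_smul _ _).symm

/-- A block diagonal compression has norm at most the norm of the operator: it is an average of
operators `U a V` with contractive multiplication operators `U` and `V`. -/
theorem norm_sum_blocks_le {ι : Type*} [Fintype ι] {e g : ι → X →ᵇ ℂ}
    (he : ∀ i x, ‖e i x‖ ≤ 1) (hde : Pairwise fun i j => ∀ x, e i x = 0 ∨ e j x = 0)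
    (hg : ∀ i x, ‖g i x‖ ≤ 1) (hdg : Pairwise fun i j => ∀ x, g i x = 0 ∨ g j x = 0)
    (a : BOp X E p) : ‖∑ i, mulOp (e i) * a * mulOp (g i)‖ ≤ ‖a‖ := by
  classical
  have := norm_sum_mul_mul_sub_le (fun i => (mulOp (e i) : BOp X E p)) (fun i => mulOp (g i)) a 0
    (C := ‖a‖) (fun σ => ?_)
  · rwa [sub_zero] at this
  · rw [sub_zero, sum_smul_mulOp, sum_smul_mulOp]
    exact norm_mulOp_mul_mulOp_le (norm_sum_sign_smul_le_one he hde σ)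
      (norm_sum_sign_smul_le_one hg hdg σ) a

theorem IsCutdownFamily.norm_le_one {J : Type u} {e : J → X →ᵇ ℂ} (he : IsCutdownFamily e) (j : J)
    (x : X) : ‖e j x‖ ≤ 1 := by
  obtain ⟨t, ht, h⟩ := he.positive_contraction j x
  rw [h, Complex.norm_real, Real.norm_eq_abs, abs_of_nonneg ht.1]
  exact ht.2

theorem IsCutdownFamily.eq_zero_or {J : Type u} {e : J → X →ᵇ ℂ} (he : IsCutdownFamily e)
    {i j : J} (hij : i ≠ j) (x : X) : e i x = 0 ∨ e j x = 0 := by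
  by_contra! h
  exact Set.disjoint_left.1 (he.disjoint_supports hij) (subset_tsupport _ h.1)
    (subset_tsupport _ h.2)

theorem IsCutdownFamily.norm_sum_le {J : Type u} {e : J → X →ᵇ ℂ} (he : IsCutdownFamily e)
    (a : BOp X E p) (t : Finset J) : ‖∑ j ∈ t, mulOp (e j) * a * mulOp (e j)‖ ≤ ‖a‖ := by
  rw [← Finset.sum_coe_sort]
  have hd : Pairwise fun i j : t => ∀ x, e i x = 0 ∨ e j x = 0 := fun i j hij x =>
    he.eq_zero_or (fun h => hij (Subtype.ext h)) x
  exact norm_sum_blocks_le (e := fun i : t => e i) (g := fun i : t => e i)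
    (fun i => he.norm_le_one i) hd (fun i => he.norm_le_one i) hd a

end Blocks

/-! ### Sup-norm and completeness -/

section SupNorm

variable {X : Type u} {E : Type v} [NormedAddCommGroup E] [NormedSpace ℂ E]
  {p : ℝ≥0∞} [Fact (p = 0 ∨ 1 ≤ p)]

omit [NormedSpace ℂ E] in
theorem lp_norm_le_of_forall {q : ℝ≥0∞} (hq : q = ∞) (f : lp (fun _ : X => E) q) {C : ℝ}
    (hC : 0 ≤ C) (h : ∀ x, ‖f x‖ ≤ C) : ‖f‖ ≤ C := by
  subst hq
  exact lp.norm_le_of_forall_le hC h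

omit [Fact (p = 0 ∨ 1 ≤ p)] in
theorem normExp_eq_top_iff : normExp p = ∞ ↔ p = 0 ∨ p = ∞ := by
  unfold normExp
  split_ifs with h <;> simp [h]

omit [Fact (p = 0 ∨ 1 ≤ p)] in
theorem normExp_of_ne_zero (h : p ≠ 0) : normExp p = p := if_neg h

theorem Ell.norm_le_of_forall (hp : normExp p = ∞) {v : Ell X E p} {C : ℝ} (hC : 0 ≤ C)
    (h : ∀ x, ‖v.val x‖ ≤ C) : ‖v‖ ≤ C :=
  lp_norm_le_of_forall hp _ hC h

/-- Vanishing at infinity passes to limits in the norm, so that `ℓ^p_E(X)` is complete also for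
`p = 0`. -/
theorem isClosed_ellSub : IsClosed (ellSub X E p : Set (lp (fun _ : X => E) (normExp p))) := by
  refine isClosed_of_closure_subset fun v hv hp => ?_
  rw [tendsto_zero_iff_norm_tendsto_zero, Metric.tendsto_nhds]
  intro ε hε
  obtain ⟨w, hw, hvw⟩ := Metric.mem_closure_iff.1 hv (ε / 2) (half_pos hε)
  have h1 := (tendsto_zero_iff_norm_tendsto_zero.1 (hw hp)).eventually (gt_mem_nhds (half_pos hε))
  filter_upwards [h1] with x hx
  have h2 : ‖(v - w : lp (fun _ : X => E) (normExp p)) x‖ ≤ ‖v - w‖ :=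
    lp.norm_apply_le_norm (normExp_ne_zero p) _ x
  rw [lp.coeFn_sub, Pi.sub_apply] at h2
  rw [dist_eq_norm] at hvw
  rw [dist_zero_right, norm_norm]
  have h3 := norm_add_le (v x - w x) (w x)
  rw [sub_add_cancel] at h3
  linarith

instance [CompleteSpace E] : CompleteSpace (Ell X E p) :=
  (isClosed_ellSub (X := X) (E := E) (p := p)).completeSpace_coe

end SupNorm

/-! ### Finitely supported vectors -/

section Density

variable {X : Type u} [MetricSpace X] [DiscreteTopology X] {E : Type v} [NormedAddCommGroup E]
  [NormedSpace ℂ E] {p : ℝ≥0∞} [Fact (p = 0 ∨ 1 ≤ p)]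

/-- The finitely supported vectors are dense in `ℓ^p_E(X)` for `p ≠ ∞`. -/
theorem exists_finset_norm_sub_lt (hp : p ≠ ∞) (v : Ell X E p) {ε : ℝ} (hε : 0 < ε) :
    ∃ G : Finset X, ‖v - mulOp (ind (G : Set X)) v‖ < ε := by
  classical
  by_cases h0 : p = 0
  · have h1 : Filter.Tendsto (fun x => v.val x) Filter.cofinite (𝓝 0) := v.2 h0
    have h2 := (tendsto_zero_iff_norm_tendsto_zero.1 h1).eventually (gt_mem_nhds (half_pos hε))
    rw [Filter.eventually_cofinite] at h2
    refine ⟨h2.toFinset, lt_of_le_of_lt ?_ (half_lt_self hε)⟩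
    refine Ell.norm_le_of_forall (normExp_eq_top_iff.2 (Or.inl h0)) (half_pos hε).le fun x => ?_
    rw [Ell.val_sub]
    by_cases hx : ‖v.val x‖ < ε / 2
    · rw [mulOp_ind_val_of_notMem (by simpa using hx), sub_zero]
      exact hx.le
    · rw [mulOp_ind_val_of_mem (by simpa using hx), sub_self, norm_zero]
      exact (half_pos hε).le
  · have hq : normExp p ≠ ∞ := by rwa [normExp_of_ne_zero h0]
    have h1 := lp.hasSum_single hq (v : lp (fun _ : X => E) (normExp p))
    obtain ⟨G, hG⟩ := (Metric.tendsto_nhds.1 h1 ε hε).exists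
    refine ⟨G, ?_⟩
    rw [dist_comm, dist_eq_norm] at hG
    refine lt_of_eq_of_lt ?_ hG
    change ‖((v - mulOp (ind (G : Set X)) v : Ell X E p) : lp (fun _ : X => E) (normExp p))‖ = _
    congr 1
    apply lp.ext
    funext x
    rw [lp.coeFn_sub, Pi.sub_apply, lp.coeFn_sum, Finset.sum_apply]
    change v.val x - (mulOp (ind (G : Set X)) v).val x = v.val x - _
    congr 1
    simp only [lp.single_apply]
    by_cases hx : x ∈ G
    · rw [mulOp_ind_val_of_mem (by simpa using hx), Finset.sum_eq_single x]
      · simp [Ell.val]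
      · intro b _ hb
        simp [hb.symm]
      · exact fun h => absurd hx h
    · rw [mulOp_ind_val_of_notMem (by simpa using hx), eq_comm]
      refine Finset.sum_eq_zero fun b hb => ?_
      have : x ≠ b := fun h => hx (h ▸ hb)
      simp [this]

/-- Norm bounds may be checked on finitely supported vectors if `p ≠ ∞`. -/
theorem opNorm_le_of_finite_support (hp : p ≠ ∞) {d : BOp X E p} {C : ℝ} (hC : 0 ≤ C)
    (h : ∀ (v : Ell X E p) (G : Finset X), (∀ x ∉ G, v.val x = 0) → ‖d v‖ ≤ C * ‖v‖) :
    ‖d‖ ≤ C := by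
  refine d.opNorm_le_bound hC fun v => ?_
  have hcl : IsClosed {w : Ell X E p | ‖d w‖ ≤ C * ‖w‖} :=
    isClosed_le (by fun_prop) (by fun_prop)
  refine hcl.closure_subset (Metric.mem_closure_iff.2 fun ε hε => ?_)
  obtain ⟨G, hG⟩ := exists_finset_norm_sub_lt hp v hε
  refine ⟨_, h (mulOp (ind (G : Set X)) v) G fun x hx => ?_, by rwa [dist_eq_norm]⟩
  exact mulOp_ind_val_of_notMem (by simpa using hx) v

end Density

/-! ### Existence of block cutdowns -/

section Cutdown

variable {X : Type u} [MetricSpace X] [DiscreteTopology X] {E : Type v} [NormedAddCommGroup E]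
  [NormedSpace ℂ E] {p : ℝ≥0∞} [Fact (p = 0 ∨ 1 ≤ p)]

/-- The partial sums of a block cutdown are bounded by `‖a‖`, and only finitely many terms see a given
finitely supported vector. -/
theorem IsCutdownFamily.summable [CompleteSpace E] {J : Type u} {e : J → X →ᵇ ℂ}
    (he : IsCutdownFamily e) (hp : p ≠ ∞) (a : BOp X E p) (v : Ell X E p) :
    Summable fun j => (mulOp (e j) * a * mulOp (e j) : BOp X E p) v := by
  classical
  rw [summable_iff_vanishing_norm]
  intro ε hε
  have hpos : 0 < ‖a‖ + 1 := by positivity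
  obtain ⟨G, hG⟩ := exists_finset_norm_sub_lt hp v (div_pos hε hpos)
  have hfin : {j | ∃ x ∈ G, e j x ≠ 0}.Finite := by
    have h1 : {j | ∃ x ∈ G, e j x ≠ 0} = ⋃ x ∈ G, {j | e j x ≠ 0} := by
      ext j; simp
    rw [h1]
    refine G.finite_toSet.biUnion fun x _ => Set.Subsingleton.finite fun i hi j hj => ?_
    by_contra hij
    exact (he.eq_zero_or hij x).elim hi hj
  refine ⟨hfin.toFinset, fun t ht => ?_⟩
  have h2 : ∑ j ∈ t, (mulOp (e j) * a * mulOp (e j) : BOp X E p) v =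
      (∑ j ∈ t, mulOp (e j) * a * mulOp (e j) : BOp X E p) (v - mulOp (ind (G : Set X)) v) := by
    rw [sum_apply]
    refine Finset.sum_congr rfl fun j hj => ?_
    have h3 : mulOp (e j) (mulOp (ind (G : Set X)) v) = 0 := by
      ext x
      rw [mulOp_apply_val, Ell.val_zero]
      by_cases hx : x ∈ G
      · have : e j x = 0 := by
          by_contra hne
          exact Finset.disjoint_left.1 ht hj (hfin.mem_toFinset.2 ⟨x, hx, hne⟩)
        rw [this, zero_smul]
      · rw [mulOp_ind_val_of_notMem (by simpa using hx), smul_zero]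
    simp only [mul_apply_eq_comp, map_sub, h3, map_zero, sub_zero]
  rw [h2]
  refine lt_of_le_of_lt (ContinuousLinearMap.le_of_opNorm_le _ (he.norm_sum_le a t) _) ?_
  calc ‖a‖ * ‖v - mulOp (ind (G : Set X)) v‖ ≤ (‖a‖ + 1) * ‖v - mulOp (ind (G : Set X)) v‖ := by
        gcongr; linarith
    _ < (‖a‖ + 1) * (ε / (‖a‖ + 1)) := by gcongr
    _ = ε := by field_simp

omit [DiscreteTopology X] in
/-- At each point, at most one block contributes. -/
theorem IsCutdownFamily.exists_hasSum_val {J : Type u} {e : J → X →ᵇ ℂ}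
    (he : IsCutdownFamily e) (a : BOp X E p) (v : Ell X E p) (x : X) :
    ∃ y : E, ‖y‖ ≤ ‖a‖ * ‖v‖ ∧
      HasSum (fun j => ((mulOp (e j) * a * mulOp (e j) : BOp X E p) v).val x) y := by
  have hval : ∀ j, e j x = 0 → ((mulOp (e j) * a * mulOp (e j) : BOp X E p) v).val x = 0 := by
    intro j hj
    rw [mul_apply_eq_comp, mul_apply_eq_comp, mulOp_apply_val, hj,
      zero_smul]
  by_cases h : ∃ i, e i x ≠ 0
  · obtain ⟨i, hi⟩ := h
    refine ⟨_, ?_, hasSum_single i fun j hj => hval j ((he.eq_zero_or hj x).resolve_right hi)⟩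
    refine (Ell.norm_val_le _ x).trans ?_
    exact ContinuousLinearMap.le_of_opNorm_le _
      (norm_mulOp_mul_mulOp_le (he.norm_le_one i) (he.norm_le_one i) a) v
  · push Not at h
    refine ⟨0, by rw [norm_zero]; positivity, ?_⟩
    simp only [hval _ (h _)]
    exact hasSum_zero

/-- Block cutdowns exist. -/
theorem IsCutdownFamily.exists_isBlockCutdown [CompleteSpace E] {J : Type u} {e : J → X →ᵇ ℂ}
    (he : IsCutdownFamily e) (a : BOp X E p) : ∃ T : BOp X E p, IsBlockCutdown e a T := by
  by_cases hp : p = ∞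
  · have hp0 : p ≠ 0 := by rw [hp]; exact ENNReal.top_ne_zero
    have hq : normExp p = ∞ := normExp_eq_top_iff.2 (Or.inr hp)
    choose y hy hsum using fun v => he.exists_hasSum_val a v
    have hmem : ∀ v, Memℓp (y v) (normExp p) := by
      intro v
      rw [hq]
      refine memℓp_infty ⟨‖a‖ * ‖v‖, ?_⟩
      rintro _ ⟨x, rfl⟩
      exact hy v x
    let F : Ell X E p → Ell X E p := fun v => ⟨⟨y v, hmem v⟩, fun h => absurd h hp0⟩
    have hF : ∀ v x, (F v).val x = y v x := fun _ _ => rfl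
    let T : BOp X E p := LinearMap.mkContinuous
      { toFun := F
        map_add' := fun v w => by
          ext x
          rw [Ell.val_add, hF, hF, hF]
          refine (hsum (v + w) x).unique ?_
          simpa using (hsum v x).add (hsum w x)
        map_smul' := fun c v => by
          ext x
          rw [RingHom.id_apply, Ell.val_smul, hF, hF]
          refine (hsum (c • v) x).unique ?_
          simpa using (hsum v x).const_smul c } ‖a‖
      (fun v => Ell.norm_le_of_forall hq (by positivity) fun x => hy v x)
    refine ⟨T, ?_⟩
    rw [IsBlockCutdown, if_pos hp]
    exact fun v x => hsum v x
  · have hs := he.summable hp a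
    let T : BOp X E p := LinearMap.mkContinuous
      { toFun := fun v => ∑' j, (mulOp (e j) * a * mulOp (e j) : BOp X E p) v
        map_add' := fun v w => by
          simp only [map_add]
          exact (hs v).tsum_add (hs w)
        map_smul' := fun c v => by
          simp only [map_smul, RingHom.id_apply]
          exact (hs v).tsum_const_smul c } ‖a‖
      (fun v => by
        refine le_of_tendsto (hs v).hasSum.norm (Filter.Eventually.of_forall fun t => ?_)
        rw [← sum_apply]
        exact ContinuousLinearMap.le_of_opNorm_le _ (he.norm_sum_le a t) v)
    refine ⟨T, ?_⟩
    rw [IsBlockCutdown, if_neg hp]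
    exact fun v => (hs v).hasSum

omit [DiscreteTopology X] in
theorem IsBlockCutdown.hasSum_val {J : Type u} {e : J → X →ᵇ ℂ} {a T : BOp X E p}
    (h : IsBlockCutdown e a T) (v : Ell X E p) (x : X) :
    HasSum (fun j => ((mulOp (e j) * a * mulOp (e j) : BOp X E p) v).val x) ((T v).val x) := by
  rw [IsBlockCutdown] at h
  split_ifs at h with hp
  · exact h v x
  · exact (h v).mapL (evalCLM x)

end Cutdown

/-! ### Almost commutation and quasi-locality -/

section AlmostCommuting

variable {X : Type u} [MetricSpace X] {E : Type v} [NormedAddCommGroup E] [NormedSpace ℂ E]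
  {p : ℝ≥0∞} [Fact (p = 0 ∨ 1 ≤ p)]

/-- An `L`-Lipschitz function with values in `[0,1]`. -/
structure IsSlow (L : ℝ) (f : X →ᵇ ℂ) : Prop where
  mem_Icc : ∀ x, ∃ t ∈ Set.Icc (0 : ℝ) 1, f x = (t : ℂ)
  lipschitz : ∀ x y, ‖f x - f y‖ ≤ L * dist x y

theorem IsSlow.norm_le_one {L : ℝ} {f : X →ᵇ ℂ} (hf : IsSlow L f) (x : X) : ‖f x‖ ≤ 1 := by
  obtain ⟨t, ht, h⟩ := hf.mem_Icc x
  rw [h, Complex.norm_real, Real.norm_eq_abs, abs_of_nonneg ht.1]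
  exact ht.2

theorem IsSlow.norm_sub_le_one {L : ℝ} {f : X →ᵇ ℂ} (hf : IsSlow L f) (x y : X) :
    ‖f x - f y‖ ≤ 1 := by
  obtain ⟨t, ht, h⟩ := hf.mem_Icc x
  obtain ⟨s, hs, h'⟩ := hf.mem_Icc y
  rw [h, h', ← Complex.ofReal_sub, Complex.norm_real, Real.norm_eq_abs, abs_le]
  constructor <;> linarith [ht.1, ht.2, hs.1, hs.2]

theorem IsSlow.mono {L L' : ℝ} {f : X →ᵇ ℂ} (hf : IsSlow L f) (h : L ≤ L') : IsSlow L' f :=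
  ⟨hf.mem_Icc, fun x y => (hf.lipschitz x y).trans (by gcongr)⟩

/-- The commutators of `a` with `L`-Lipschitz functions `X → [0,1]` become uniformly small as `L`
tends to zero. -/
def AlmostCommutes (a : BOp X E p) : Prop :=
  ∀ ε > 0, ∃ L > 0, ∀ f : X →ᵇ ℂ, IsSlow L f → ‖a * mulOp f - mulOp f * a‖ ≤ ε

omit [MetricSpace X] in
theorem norm_commutator_le (a m : BOp X E p) : ‖a * m - m * a‖ ≤ 2 * ‖a‖ * ‖m‖ := by
  refine (norm_sub_le _ _).trans ?_
  have h1 := norm_mul_le a m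
  have h2 := norm_mul_le m a
  nlinarith

theorem almostCommutes_of_mem_closure {S : Set (BOp X E p)} (hS : ∀ a ∈ S, AlmostCommutes a)
    {a : BOp X E p} (ha : a ∈ closure S) : AlmostCommutes a := by
  intro ε hε
  obtain ⟨a', ha', hd⟩ := Metric.mem_closure_iff.1 ha (ε / 4) (by positivity)
  obtain ⟨L, hL, h⟩ := hS a' ha' (ε / 2) (by positivity)
  refine ⟨L, hL, fun f hf => ?_⟩
  have h1 := h f hf
  rw [dist_eq_norm] at hd
  have h2 := norm_commutator_le (a - a') (mulOp f)
  have h3 : ‖(mulOp f : BOp X E p)‖ ≤ 1 := norm_mulOp_le_of_forall zero_le_one hf.norm_le_one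
  have h4 : a * mulOp f - mulOp f * a =
      ((a - a') * mulOp f - mulOp f * (a - a')) + (a' * mulOp f - mulOp f * a') := by
    noncomm_ring
  rw [h4]
  refine (norm_add_le _ _).trans ?_
  nlinarith [norm_nonneg (a - a'), norm_nonneg (mulOp f : BOp X E p)]

variable [DiscreteTopology X]

theorem ind_compl_eq_add {S T : Set X} (h : T ⊆ S) : ind Tᶜ = ind (S \ T) + ind Sᶜ := by
  ext x
  rw [BoundedContinuousFunction.add_apply]
  by_cases hS : x ∈ S <;> by_cases hT : x ∈ T
  · simp [ind, hS, hT]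
  · simp [ind, hS, hT]
  · exact absurd (h hT) hS
  · simp [ind, hS, hT]

theorem ind_eq_diff_add {S T : Set X} (h : T ⊆ S) : ind S = ind (S \ T) + ind T := by
  ext x
  rw [BoundedContinuousFunction.add_apply]
  by_cases hS : x ∈ S <;> by_cases hT : x ∈ T
  · simp [ind, hS, hT]
  · simp [ind, hS, hT]
  · exact absurd (h hT) hS
  · simp [ind, hS, hT]

theorem card_range_filter_le {n : ℕ} {s : ℝ} (h0 : 0 ≤ s) (h : s ≤ n) :
    ((Finset.range n).filter fun k : ℕ => ((k + 1 : ℕ) : ℝ) ≤ s).card = ⌊s⌋₊ := by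
  have : (Finset.range n).filter (fun k : ℕ => ((k + 1 : ℕ) : ℝ) ≤ s) = Finset.range ⌊s⌋₊ := by
    ext k
    rw [Finset.mem_filter, Finset.mem_range, Finset.mem_range, ← Nat.le_floor_iff h0]
    have : ⌊s⌋₊ ≤ n := Nat.floor_le_of_le h
    omega
  rw [this, Finset.card_range]

/-- Operators of finite propagation almost commute with slowly varying functions: for a step function
`g = n⁻¹ ∑ k, 1_{E k}` with steps wider than the propagation, the commutator `[a, g]` is `n⁻¹` times
the difference of two block diagonal compressions of `a`. -/
theorem FinitePropagation.almostCommutes {a : BOp X E p} (ha : FinitePropagation a) :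
    AlmostCommutes a := by
  obtain ⟨R, hR, ha⟩ := ha
  intro ε hε
  obtain ⟨n, hn⟩ := exists_nat_gt (4 * ‖a‖ / ε)
  have hn0 : (0 : ℝ) < n := lt_of_le_of_lt (by positivity) hn
  refine ⟨1 / (n * (R + 1)), by positivity, fun f hf => ?_⟩
  choose F hF hfF using hf.mem_Icc
  have hgap : ∀ x y, n * F x + 1 ≤ n * F y → R + 1 ≤ dist x y := by
    intro x y hxy
    have h1 := hf.lipschitz x y
    rw [hfF, hfF, ← Complex.ofReal_sub, Complex.norm_real, Real.norm_eq_abs] at h1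
    have h2 : F y - F x ≤ 1 / (n * (R + 1)) * dist x y := by
      rw [abs_sub_comm] at h1
      exact (le_abs_self _).trans h1
    have h3 : 1 ≤ n * (F y - F x) := by linarith
    have h4 : 1 ≤ n * (1 / (n * (R + 1)) * dist x y) := h3.trans (by gcongr)
    have h5 : (n : ℝ) * (1 / (n * (R + 1)) * dist x y) = dist x y / (R + 1) := by field_simp
    rw [h5, le_div_iff₀ (by linarith)] at h4
    linarith
  -- nested superlevel sets: the complement of `D k` and `D (k + 1)` are further apart than `R`
  let D : ℕ → Set X := fun k => {x | (k : ℝ) ≤ n * F x}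
  have hD : ∀ k, D (k + 1) ⊆ D k := by
    intro k x hx
    change ((k + 1 : ℕ) : ℝ) ≤ n * F x at hx
    change (k : ℝ) ≤ n * F x
    push_cast at hx
    linarith
  have hz1 : ∀ k S T, S ⊆ (D k)ᶜ → T ⊆ D (k + 1) → mulOp (ind S) * a * mulOp (ind T) = 0 := by
    intro k S T hS hT
    refine ha.ind_mul_ind hR fun x hx y hy => hgap x y ?_
    have h1 : ¬ (k : ℝ) ≤ n * F x := hS hx
    have h2 : ((k + 1 : ℕ) : ℝ) ≤ n * F y := hT hy
    push_cast at h2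
    linarith
  have hz2 : ∀ k S T, S ⊆ (D k)ᶜ → T ⊆ D (k + 1) → mulOp (ind T) * a * mulOp (ind S) = 0 := by
    intro k S T hS hT
    refine ha.ind_mul_ind hR fun x hx y hy => ?_
    rw [dist_comm]
    refine hgap y x ?_
    have h1 : ¬ (k : ℝ) ≤ n * F y := hS hy
    have h2 : ((k + 1 : ℕ) : ℝ) ≤ n * F x := hT hx
    push_cast at h2
    linarith
  let P : ℕ → X →ᵇ ℂ := fun k => ind (D k \ D (k + 1))
  have hPd : ∀ i j, i ≠ j → ∀ x, P i x = 0 ∨ P j x = 0 := by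
    have key : ∀ i j, i < j → ∀ x, P i x = 0 ∨ P j x = 0 := by
      intro i j hij x
      by_cases hx : x ∈ D (i + 1)
      · exact Or.inl (ind_of_notMem fun h => h.2 hx)
      · refine Or.inr (ind_of_notMem fun h => hx ?_)
        exact antitone_nat_of_succ_le (f := D) hD hij h.1
    intro i j hij x
    rcases lt_or_gt_of_ne hij with h | h
    · exact key i j h x
    · exact (key j i h x).symm
  -- by finite propagation, only the layers adjacent to the boundary of `D (k + 1)` contribute
  have hc : ∀ k, a * mulOp (ind (D (k + 1))) - mulOp (ind (D (k + 1))) * a =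
      mulOp (P k) * a * mulOp (P (k + 1)) - mulOp (P (k + 1)) * a * mulOp (P k) := by
    intro k
    have h0 : (1 : BOp X E p) - mulOp (ind (D (k + 1))) = mulOp (ind (D (k + 1))ᶜ) := by
      rw [← one_sub_ind, mulOp_sub, mulOp_one]
    have h1 : mulOp (ind (D (k + 1))ᶜ) = (mulOp (P k) + mulOp (ind (D k)ᶜ) : BOp X E p) := by
      rw [ind_compl_eq_add (hD k), mulOp_add]
    have h2 : mulOp (ind (D (k + 1))) =
        (mulOp (P (k + 1)) + mulOp (ind (D (k + 2))) : BOp X E p) := by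
      rw [ind_eq_diff_add (hD (k + 1)), mulOp_add]
    have e1 : mulOp (ind (D (k + 1))ᶜ) * a * mulOp (ind (D (k + 1))) =
        mulOp (P k) * a * mulOp (P (k + 1)) := by
      have z1 : mulOp (ind (D k)ᶜ) * a * mulOp (ind (D (k + 1))) = 0 :=
        hz1 k _ _ subset_rfl subset_rfl
      have z2 : mulOp (P k) * a * mulOp (ind (D (k + 2))) = 0 :=
        hz1 (k + 1) _ _ (fun x hx => hx.2) subset_rfl
      rw [h1, add_mul, add_mul, z1, add_zero, h2, mul_add, z2, add_zero]
    have e2 : mulOp (ind (D (k + 1))) * a * mulOp (ind (D (k + 1))ᶜ) =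
        mulOp (P (k + 1)) * a * mulOp (P k) := by
      have z1 : mulOp (ind (D (k + 1))) * a * mulOp (ind (D k)ᶜ) = 0 :=
        hz2 k _ _ subset_rfl subset_rfl
      have z2 : mulOp (ind (D (k + 2))) * a * mulOp (P k) = 0 :=
        hz2 (k + 1) _ _ (fun x hx => hx.2) subset_rfl
      rw [h1, mul_add, z1, add_zero, h2, add_mul, add_mul, z2, add_zero]
    rw [← e1, ← e2, ← h0]
    noncomm_ring
  -- the step function `g = n⁻¹ * ⌊n f⌋`
  let g : X →ᵇ ℂ := ((n : ℂ)⁻¹) • ∑ k : Fin n, ind (D (k + 1))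
  have hfg : ∀ x, ‖(f - g) x‖ ≤ 1 / n := by
    intro x
    have hFx := hF x
    have h0 : 0 ≤ n * F x := mul_nonneg hn0.le hFx.1
    have hg : g x = (n : ℂ)⁻¹ * (⌊n * F x⌋₊ : ℂ) := by
      rw [BoundedContinuousFunction.smul_apply, BoundedContinuousFunction.coe_sum,
        Finset.sum_apply, smul_eq_mul]
      congr 1
      rw [← card_range_filter_le h0 (by nlinarith [hFx.2] : n * F x ≤ n)]
      rw [Fin.sum_univ_eq_sum_range (fun k => ind (D (k + 1)) x) n, Finset.card_filter]
      push_cast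
      refine Finset.sum_congr rfl fun k _ => ?_
      simp [ind, D]
    rw [BoundedContinuousFunction.sub_apply, hg, hfF]
    have h1 : ((F x : ℝ) : ℂ) - (n : ℂ)⁻¹ * (⌊n * F x⌋₊ : ℂ) =
        ((F x - (n : ℝ)⁻¹ * ⌊n * F x⌋₊ : ℝ) : ℂ) := by push_cast; rfl
    rw [h1, Complex.norm_real, Real.norm_eq_abs]
    have h2 : F x - (n : ℝ)⁻¹ * ⌊n * F x⌋₊ = (n * F x - ⌊n * F x⌋₊) / n := by field_simp
    rw [h2, abs_div, abs_of_pos hn0]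
    gcongr
    have h3 := Nat.floor_le h0
    have h4 := Nat.lt_floor_add_one (n * F x)
    rw [abs_le]
    constructor <;> linarith
  have hcg : a * mulOp g - mulOp g * a = ((n : ℂ)⁻¹) •
      (∑ k : Fin n, mulOp (P k) * a * mulOp (P (k + 1)) -
        ∑ k : Fin n, mulOp (P (k + 1)) * a * mulOp (P k)) := by
    rw [← Finset.sum_sub_distrib]
    simp only [← hc]
    rw [mulOp_smul, mulOp_sum, mul_smul_comm, smul_mul_assoc, ← smul_sub, Finset.mul_sum,
      Finset.sum_mul, Finset.sum_sub_distrib]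
  have hb1 : ‖∑ k : Fin n, mulOp (P k) * a * mulOp (P (k + 1))‖ ≤ ‖a‖ :=
    norm_sum_blocks_le (e := fun k : Fin n => P k) (g := fun k : Fin n => P (k + 1))
      (fun _ => norm_ind_le _) (fun i j hij => hPd _ _ (fun h => hij (Fin.ext h)))
      (fun _ => norm_ind_le _) (fun i j hij => hPd _ _ (fun h => hij (Fin.ext (by omega)))) a
  have hb2 : ‖∑ k : Fin n, mulOp (P (k + 1)) * a * mulOp (P k)‖ ≤ ‖a‖ :=
    norm_sum_blocks_le (e := fun k : Fin n => P (k + 1)) (g := fun k : Fin n => P k)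
      (fun _ => norm_ind_le _) (fun i j hij => hPd _ _ (fun h => hij (Fin.ext (by omega))))
      (fun _ => norm_ind_le _) (fun i j hij => hPd _ _ (fun h => hij (Fin.ext h))) a
  have hn1 : ‖a * mulOp g - mulOp g * a‖ ≤ 2 * ‖a‖ / n := by
    rw [hcg, norm_smul, norm_inv, Complex.norm_natCast, div_eq_inv_mul]
    gcongr
    exact (norm_sub_le _ _).trans (by linarith)
  have hn2 : ‖a * mulOp (f - g) - mulOp (f - g) * a‖ ≤ 2 * ‖a‖ / n := by
    refine (norm_commutator_le a _).trans ?_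
    rw [div_eq_mul_one_div]
    gcongr
    exact norm_mulOp_le_of_forall (by positivity) hfg
  have hsplit : a * mulOp f - mulOp f * a =
      (a * mulOp (f - g) - mulOp (f - g) * a) + (a * mulOp g - mulOp g * a) := by
    rw [mulOp_sub]
    noncomm_ring
  rw [hsplit]
  refine (norm_add_le _ _).trans ((add_le_add hn2 hn1).trans ?_)
  rw [← add_div, div_le_iff₀ hn0]
  rw [div_lt_iff₀ hε] at hn
  linarith

theorem almostCommutes_of_mem_roe {B : Set (BOp X E p)} {a : BOp X E p} (ha : a ∈ roe B) :
    AlmostCommutes a :=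
  almostCommutes_of_mem_closure (fun _ h => h.2.almostCommutes) ha

omit [DiscreteTopology X] in
/-- On a function vanishing at infinity, a slowly varying function is nearly constant. -/
theorem exists_norm_sub_const_mul_le (x₀ : X) (f₀ : ZeroAtInftyContinuousMap X ℂ) {ε : ℝ}
    (hε : 0 < ε) : ∃ L > 0, ∀ f : X →ᵇ ℂ, IsSlow L f →
      ‖(mulOp (f - f x₀ • 1) * mulOp f₀.toBCF : BOp X E p)‖ ≤ ε := by
  have h1 : ∀ᶠ x in Filter.cocompact X, ‖f₀ x‖ < ε :=
    (tendsto_zero_iff_norm_tendsto_zero.1 f₀.zero_at_infty').eventually (gt_mem_nhds hε)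
  obtain ⟨K, hK, hKs⟩ := Filter.mem_cocompact.1 h1
  obtain ⟨r, hr⟩ := hK.isBounded.subset_closedBall x₀
  set C := ‖f₀.toBCF‖
  have hC : 0 ≤ C := norm_nonneg _
  have hden : 0 < (|r| + 1) * (C + 1) := by positivity
  refine ⟨ε / ((|r| + 1) * (C + 1)), by positivity, fun f hf => ?_⟩
  rw [← mulOp_mul]
  refine norm_mulOp_le_of_forall hε.le fun x => ?_
  have hval : ((f - f x₀ • (1 : X →ᵇ ℂ)) * f₀.toBCF) x = (f x - f x₀) * f₀ x := by simp
  rw [hval, norm_mul]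
  by_cases hx : x ∈ K
  · have h2 : dist x x₀ ≤ |r| + 1 := (Metric.mem_closedBall.1 (hr hx)).trans
      ((le_abs_self r).trans (by linarith))
    have h3 : ‖f₀ x‖ ≤ C + 1 := (f₀.toBCF.norm_coe_le_norm x).trans (by linarith)
    calc ‖f x - f x₀‖ * ‖f₀ x‖
        ≤ (ε / ((|r| + 1) * (C + 1)) * (|r| + 1)) * (C + 1) := by
          gcongr
          exact (hf.lipschitz x x₀).trans (by gcongr)
      _ = ε := by field_simp
  · have h2 : ‖f₀ x‖ < ε := hKs hx
    calc ‖f x - f x₀‖ * ‖f₀ x‖ ≤ 1 * ε := by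
          gcongr
          exact hf.norm_sub_le_one x x₀
      _ = ε := one_mul _

omit [DiscreteTopology X] in
/-- Against an element of `𝒦(X, B)`, a slowly varying function is nearly constant. -/
theorem exists_norm_sub_const_mul_compactPart_le (x₀ : X) {B : Set (BOp X E p)} {k : BOp X E p}
    (hk : k ∈ compactPart B) {ε : ℝ} (hε : 0 < ε) : ∃ L > 0, ∀ f : X →ᵇ ℂ, IsSlow L f →
      ‖mulOp (f - f x₀ • 1) * k‖ ≤ ε ∧ ‖k * mulOp (f - f x₀ • 1)‖ ≤ ε := by
  obtain ⟨_, ⟨f₀, g₀, c, -, rfl⟩, hd⟩ := Metric.mem_closure_iff.1 hk (ε / 2) (half_pos hε)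
  rw [dist_eq_norm] at hd
  set m := mulOp f₀.toBCF * c * mulOp g₀.toBCF with hm
  set C := ‖c * mulOp g₀.toBCF‖ + ‖mulOp f₀.toBCF * c‖ + 1 with hC
  have hC1 : ‖c * mulOp g₀.toBCF‖ ≤ C := by
    linarith [norm_nonneg (mulOp f₀.toBCF * c)]
  have hC2 : ‖mulOp f₀.toBCF * c‖ ≤ C := by
    linarith [norm_nonneg (c * mulOp g₀.toBCF)]
  have hC0 : 0 < C := by
    linarith [norm_nonneg (c * mulOp g₀.toBCF), norm_nonneg (mulOp f₀.toBCF * c)]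
  have hδ : 0 < ε / 2 / C := by positivity
  obtain ⟨L₁, hL₁, h₁⟩ := exists_norm_sub_const_mul_le (E := E) (p := p) x₀ f₀ hδ
  obtain ⟨L₂, hL₂, h₂⟩ := exists_norm_sub_const_mul_le (E := E) (p := p) x₀ g₀ hδ
  refine ⟨min L₁ L₂, lt_min hL₁ hL₂, fun f hf => ?_⟩
  have hn : ∀ x, ‖(f - f x₀ • (1 : X →ᵇ ℂ)) x‖ ≤ 1 := by
    intro x
    simpa using hf.norm_sub_le_one x x₀
  have e1 := h₁ f (hf.mono (min_le_left _ _))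
  have e2 := h₂ f (hf.mono (min_le_right _ _))
  set h := f - f x₀ • (1 : X →ᵇ ℂ)
  constructor
  · have h3 : mulOp h * k = mulOp h * (k - m) + mulOp h * mulOp f₀.toBCF * (c * mulOp g₀.toBCF) := by
      rw [hm]; noncomm_ring
    rw [h3]
    calc _ ≤ ‖k - m‖ + ‖(mulOp h * mulOp f₀.toBCF : BOp X E p)‖ * ‖c * mulOp g₀.toBCF‖ :=
          (norm_add_le _ _).trans (add_le_add (norm_mulOp_mul_le hn _) (norm_mul_le _ _))
      _ ≤ ε / 2 + ε / 2 / C * C := by gcongr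
      _ = ε := by field_simp; norm_num
  · have h3 : k * mulOp h = (k - m) * mulOp h + (mulOp f₀.toBCF * c) * (mulOp h * mulOp g₀.toBCF) := by
      rw [hm, mulOp_comm h]; noncomm_ring
    rw [h3]
    calc _ ≤ ‖k - m‖ + ‖mulOp f₀.toBCF * c‖ * ‖(mulOp h * mulOp g₀.toBCF : BOp X E p)‖ :=
          (norm_add_le _ _).trans (add_le_add (norm_mul_mulOp_le hn _) (norm_mul_le _ _))
      _ ≤ ε / 2 + C * (ε / 2 / C) := by gcongr
      _ = ε := by field_simp; norm_num

omit [DiscreteTopology X] in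
/-- Almost commutation passes to inverses modulo `𝒦(X, B)`, by the identity
`[b, f] = b [f, a] b + b (f - t) (1 - a b) - (1 - b a) (f - t) b`, valid for every scalar `t`; with
`t = f x₀`, the last two terms are small because `f` is nearly constant on finite sets. -/
theorem AlmostCommutes.of_inverse_mod_compact {B : Set (BOp X E p)} {a b : BOp X E p}
    (ha : AlmostCommutes a) (hab : 1 - a * b ∈ compactPart B) (hba : 1 - b * a ∈ compactPart B) :
    AlmostCommutes b := by
  intro ε hε
  rcases isEmpty_or_nonempty X with hX | ⟨⟨x₀⟩⟩
  · refine ⟨1, one_pos, fun f _ => ?_⟩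
    have : f = 0 := by
      ext x; exact hX.elim x
    rw [this, mulOp_zero, mul_zero, zero_mul, sub_zero, norm_zero]
    exact hε.le
  have hβ : 0 < ‖b‖ + 1 := by positivity
  obtain ⟨L₁, hL₁, h₁⟩ := ha (ε / 3 / (‖b‖ + 1) ^ 2) (by positivity)
  have hδ : 0 < ε / 3 / (‖b‖ + 1) := by positivity
  obtain ⟨L₂, hL₂, h₂⟩ := exists_norm_sub_const_mul_compactPart_le x₀ hab hδ
  obtain ⟨L₃, hL₃, h₃⟩ := exists_norm_sub_const_mul_compactPart_le x₀ hba hδ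
  refine ⟨min L₁ (min L₂ L₃), lt_min hL₁ (lt_min hL₂ hL₃), fun f hf => ?_⟩
  have e1 := h₁ f (hf.mono (min_le_left _ _))
  have e2 := (h₂ f (hf.mono ((min_le_right _ _).trans (min_le_left _ _)))).1
  have e3 := (h₃ f (hf.mono ((min_le_right _ _).trans (min_le_right _ _)))).2
  have hid : b * mulOp f - mulOp f * b = -(b * (a * mulOp f - mulOp f * a) * b) +
      b * (mulOp (f - f x₀ • 1) * (1 - a * b)) - (1 - b * a) * mulOp (f - f x₀ • 1) * b := by
    rw [mulOp_sub, mulOp_smul, mulOp_one]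
    simp only [mul_sub, sub_mul, mul_one, one_mul, smul_mul_assoc, mul_smul_comm, smul_sub, mul_assoc]
    abel
  rw [hid]
  have t1 : ‖-(b * (a * mulOp f - mulOp f * a) * b)‖ ≤ ε / 3 := by
    rw [norm_neg]
    calc _ ≤ ‖b‖ * ‖a * mulOp f - mulOp f * a‖ * ‖b‖ :=
          (norm_mul_le _ _).trans (by gcongr; exact norm_mul_le _ _)
      _ ≤ (‖b‖ + 1) * (ε / 3 / (‖b‖ + 1) ^ 2) * (‖b‖ + 1) := by gcongr <;> linarith
      _ = ε / 3 := by field_simp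
  have t2 : ‖b * (mulOp (f - f x₀ • 1) * (1 - a * b))‖ ≤ ε / 3 :=
    calc _ ≤ ‖b‖ * ‖mulOp (f - f x₀ • 1) * (1 - a * b)‖ := norm_mul_le _ _
      _ ≤ (‖b‖ + 1) * (ε / 3 / (‖b‖ + 1)) := by gcongr; linarith
      _ = ε / 3 := by field_simp
  have t3 : ‖(1 - b * a) * mulOp (f - f x₀ • 1) * b‖ ≤ ε / 3 :=
    calc _ ≤ ‖(1 - b * a) * mulOp (f - f x₀ • 1)‖ * ‖b‖ := norm_mul_le _ _
      _ ≤ (ε / 3 / (‖b‖ + 1)) * (‖b‖ + 1) := by gcongr; linarith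
      _ = ε / 3 := by field_simp
  calc _ ≤ ε / 3 + ε / 3 + ε / 3 :=
        (norm_sub_le _ _).trans (add_le_add ((norm_add_le _ _).trans (add_le_add t1 t2)) t3)
    _ = ε := by ring

/-- Quasi-locality: the compressions of `b` between sets at distance at least `R` become uniformly
small as `R` tends to infinity. -/
def QuasiLocal (b : BOp X E p) : Prop :=
  ∀ ε > 0, ∃ R > 0, ∀ S T : Set X, (∀ x ∈ S, ∀ y ∈ T, R ≤ dist x y) →
    ‖mulOp (ind S) * b * mulOp (ind T)‖ ≤ ε

/-- Compare `b` with its commutator with a function that is `1` on `S` and `0` on `T`. -/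
theorem AlmostCommutes.quasiLocal {b : BOp X E p} (hb : AlmostCommutes b) : QuasiLocal b := by
  intro ε hε
  obtain ⟨L, hL, h⟩ := hb ε hε
  refine ⟨1 / L, by positivity, fun S T hST => ?_⟩
  rcases S.eq_empty_or_nonempty with rfl | hS
  · have : ind (∅ : Set X) = 0 := by
      ext x; exact ind_of_notMem (Set.notMem_empty x)
    rw [this, mulOp_zero, zero_mul, zero_mul, norm_zero]
    exact hε.le
  let F : X → ℝ := fun x => max 0 (1 - L * Metric.infDist x S)
  have hF0 : ∀ x, 0 ≤ F x := fun x => le_max_left _ _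
  have hF1 : ∀ x, F x ≤ 1 := fun x => max_le zero_le_one (by
    have : 0 ≤ L * Metric.infDist x S := mul_nonneg hL.le Metric.infDist_nonneg
    linarith)
  have hn : ∀ x, ‖(F x : ℂ)‖ ≤ 1 := by
    intro x
    rw [Complex.norm_real, Real.norm_eq_abs, abs_of_nonneg (hF0 x)]
    exact hF1 x
  let f : X →ᵇ ℂ := unitBCF (fun x => (F x : ℂ)) hn
  have hf : IsSlow L f := by
    refine ⟨fun x => ⟨F x, ⟨hF0 x, hF1 x⟩, rfl⟩, fun x y => ?_⟩
    change ‖(F x : ℂ) - (F y : ℂ)‖ ≤ _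
    rw [← Complex.ofReal_sub, Complex.norm_real, Real.norm_eq_abs]
    refine (abs_max_sub_max_le_max _ _ _ _).trans ?_
    have h1 : |Metric.infDist x S - Metric.infDist y S| ≤ dist x y := by
      have := (Metric.lipschitz_infDist_pt S).dist_le_mul x y
      simpa [Real.dist_eq] using this
    have h2 : (1 - L * Metric.infDist x S) - (1 - L * Metric.infDist y S) =
        -(L * (Metric.infDist x S - Metric.infDist y S)) := by ring
    rw [h2, abs_neg, abs_mul, abs_of_pos hL, sub_self, abs_zero]
    exact max_le (by positivity) (by gcongr)
  have e1 : mulOp (ind S) * mulOp f = (mulOp (ind S) : BOp X E p) := by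
    rw [← mulOp_mul]
    congr 1
    ext x
    by_cases hx : x ∈ S
    · have : F x = 1 := by
        simp [F, Metric.infDist_zero_of_mem hx]
      simp [f, this]
    · simp [ind_of_notMem hx]
  have e2 : mulOp f * mulOp (ind T) = (0 : BOp X E p) := by
    rw [← mulOp_mul]
    have : f * ind T = 0 := by
      ext x
      by_cases hx : x ∈ T
      · have h1 : 1 / L ≤ Metric.infDist x S := by
          refine (Metric.le_infDist hS).2 fun y hy => ?_
          rw [dist_comm]
          exact hST y hy x hx
        have : F x = 0 := by
          refine max_eq_left ?_
          rw [div_le_iff₀ hL] at h1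
          linarith
        simp [f, this]
      · simp [ind_of_notMem hx]
    rw [this, mulOp_zero]
  have key : mulOp (ind S) * b * mulOp (ind T) =
      mulOp (ind S) * (-(b * mulOp f - mulOp f * b)) * mulOp (ind T) := by
    have : mulOp (ind S) * (-(b * mulOp f - mulOp f * b)) * mulOp (ind T) =
        mulOp (ind S) * mulOp f * b * mulOp (ind T) -
          mulOp (ind S) * b * (mulOp f * mulOp (ind T)) := by noncomm_ring
    rw [this, e1, e2, mul_zero, sub_zero]
  rw [key]
  refine (norm_mulOp_mul_mulOp_le (norm_ind_le S) (norm_ind_le T) _).trans ?_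
  rw [norm_neg]
  exact h f hf

end AlmostCommuting

/-! ### Colouring families of bounded sets -/

section Colouring

/-- A symmetric relation with at most `K` neighbours per point has a proper colouring with `K + 1`
colours: colour greedily along a well-order. -/
theorem exists_colouring {I : Type*} (r : I → I → Prop) (hr : ∀ i j, r i j → r j i) (K : ℕ)
    (hK : ∀ i, {j | r i j}.encard ≤ K) :
    ∃ c : I → ℕ, (∀ i, c i ≤ K) ∧ ∀ i j, i ≠ j → r i j → c i ≠ c j := by
  classical
  let lt : I → I → Prop := WellOrderingRel
  have wf : WellFounded lt := IsWellFounded.wf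
  let used : (i : I) → ((j : I) → lt j i → ℕ) → Set ℕ := fun i g => {n | ∃ j h, r i j ∧ g j h = n}
  let c : I → ℕ := wf.fix fun i g => sInf (used i g)ᶜ
  have hc : ∀ i, c i = sInf {n | ∃ j, lt j i ∧ r i j ∧ c j = n}ᶜ := by
    intro i
    have h1 : c i = sInf (used i fun j _ => c j)ᶜ := wf.fix_eq _ i
    rw [h1]
    congr 2
    ext n
    simp only [used, Set.mem_ofPred_eq]
    constructor
    · rintro ⟨j, h, h', h''⟩
      exact ⟨j, h, h', h''⟩
    · rintro ⟨j, h, h', h''⟩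
      exact ⟨j, h, h', h''⟩
  -- the earlier neighbours of `i` cannot use up all of the `K + 1` colours
  have key : ∀ i, ∃ n ≤ K, n ∈ {n | ∃ j, lt j i ∧ r i j ∧ c j = n}ᶜ := by
    intro i
    by_contra! h
    have hfin : {j | r i j}.Finite := Set.finite_of_encard_le_coe (hK i)
    have h1 : Finset.range (K + 1) ⊆ hfin.toFinset.image c := by
      intro n hn
      have h2 := h n (by simpa [Nat.lt_succ_iff] using hn)
      rw [Set.notMem_compl_iff] at h2
      obtain ⟨j, -, hj, hjn⟩ := h2
      exact Finset.mem_image.2 ⟨j, hfin.mem_toFinset.2 hj, hjn⟩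
    have h2 := (Finset.card_le_card h1).trans Finset.card_image_le
    rw [Finset.card_range] at h2
    have h3 := hK i
    rw [hfin.encard_eq_coe_toFinset_card, Nat.cast_le] at h3
    omega
  have hmem : ∀ i, c i ∈ {n | ∃ j, lt j i ∧ r i j ∧ c j = n}ᶜ := by
    intro i
    obtain ⟨n, -, hn⟩ := key i
    rw [hc i]
    exact Nat.sInf_mem ⟨n, hn⟩
  refine ⟨c, fun i => ?_, fun i j hij hrij hcij => ?_⟩
  · obtain ⟨n, hn, hn'⟩ := key i
    rw [hc i]
    exact (Nat.sInf_le hn').trans hn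
  · rcases trichotomous_of lt i j with h | h | h
    · exact hmem j ⟨i, h, hr _ _ hrij, hcij⟩
    · exact hij h
    · exact hmem i ⟨j, h, hrij, hcij.symm⟩

/-- In a space of bounded geometry, a uniformly bounded family of finite multiplicity meets each of
its members a uniformly bounded number of times. -/
theorem BoundedGeometry.exists_encard_meeting_le {X : Type u} [MetricSpace X]
    (hX : BoundedGeometry X) {I : Type*} {S : I → Set X} {D : ℝ}
    (hD : ∀ i, ∀ x ∈ S i, ∀ y ∈ S i, dist x y ≤ D) {M : ℕ} (hM : ∀ x, {i | x ∈ S i}.encard ≤ M) :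
    ∃ K : ℕ, ∀ i, {j | ¬ Disjoint (S i) (S j)}.encard ≤ K := by
  obtain ⟨N, hN⟩ := hX D
  refine ⟨N * M, fun i => ?_⟩
  rcases (S i).eq_empty_or_nonempty with h | ⟨x, hx⟩
  · simp [h]
  · have hfin : (Metric.closedBall x D).Finite := hX.finite_closedBall x D
    have h1 : {j | ¬ Disjoint (S i) (S j)} ⊆ ⋃ y ∈ hfin.toFinset, {j | y ∈ S j} := by
      intro j hj
      obtain ⟨y, hy, hy'⟩ := Set.not_disjoint_iff.1 hj
      simp only [Set.mem_iUnion]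
      exact ⟨y, hfin.mem_toFinset.2 (hD i y hy x hx), hy'⟩
    refine (Set.encard_le_encard h1).trans ?_
    refine (Finset.set_encard_biUnion_le _ _).trans ?_
    refine (Finset.sum_le_card_nsmul _ _ (M : ℕ∞) fun y _ => hM y).trans ?_
    have h2 := hN x
    rw [hfin.encard_eq_coe_toFinset_card, Nat.cast_le] at h2
    rw [nsmul_eq_mul]
    exact_mod_cast Nat.mul_le_mul_right M h2

end Colouring

/-! ### Band operators -/

section Band

variable {X : Type u} [MetricSpace X] [DiscreteTopology X] {E : Type v} [NormedAddCommGroup E]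
  [NormedSpace ℂ E] {p : ℝ≥0∞} [Fact (p = 0 ∨ 1 ≤ p)]

omit [DiscreteTopology X] in
theorem mulOp_mul_mem {B : NonUnitalSubalgebra ℂ (BOp X E p)}
    (hB_cb : cbCb (B : Set (BOp X E p)) = B) (f g : X →ᵇ ℂ) {b : BOp X E p} (hb : b ∈ B) :
    mulOp f * b * mulOp g ∈ B := by
  have : mulOp f * b * mulOp g ∈ cbCb (B : Set (BOp X E p)) := ⟨f, g, b, hb, rfl⟩
  rwa [hB_cb] at this

theorem isCutdownFamily_ind {J : Type u} {S : J → Set X}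
    (hS : Pairwise fun i j => Disjoint (S i) (S j)) : IsCutdownFamily fun j => ind (S j) := by
  refine ⟨fun j x => ?_, fun i j hij => ?_⟩
  · by_cases h : x ∈ S j
    · exact ⟨1, ⟨zero_le_one, le_rfl⟩, by rw [ind_of_mem h]; simp⟩
    · exact ⟨0, ⟨le_rfl, zero_le_one⟩, by rw [ind_of_notMem h]; simp⟩
  · simp only [tsupport_ind]
    exact hS hij

/-- For disjointly supported functions `α j`, `β j`, the operator `∑ j, α j b β j` belongs to `B`: it
is the block cutdown of `b` to the supports, multiplied by `∑ j, α j` and `∑ j, β j`. -/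
theorem exists_hasSum_of_disjoint [CompleteSpace E] {B : NonUnitalSubalgebra ℂ (BOp X E p)}
    (hB_cb : cbCb (B : Set (BOp X E p)) = B)
    (hB_cut : ClosedUnderBlockCutdowns (B : Set (BOp X E p))) {b : BOp X E p} (hb : b ∈ B)
    {J : Type u} {S : J → Set X} (hS : Pairwise fun i j => Disjoint (S i) (S j))
    {α β : J → X →ᵇ ℂ} (hα : ∀ j x, ‖α j x‖ ≤ 1) (hβ : ∀ j x, ‖β j x‖ ≤ 1)
    (hαS : ∀ j, ∀ x ∉ S j, α j x = 0) (hβS : ∀ j, ∀ x ∉ S j, β j x = 0) :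
    ∃ T ∈ B, ∀ (v : Ell X E p) (x : X),
      HasSum (fun j => α j x • (b (mulOp (β j) v)).val x) ((T v).val x) := by
  classical
  obtain ⟨C, hC⟩ := (isCutdownFamily_ind hS).exists_isBlockCutdown b
  have hCB : C ∈ B := hB_cut b hb J _ (isCutdownFamily_ind hS) C hC
  -- the sum of a disjointly supported family of contractions, as a single contraction
  have hglue : ∀ γ : J → X →ᵇ ℂ, (∀ j x, ‖γ j x‖ ≤ 1) → ∃ g : X →ᵇ ℂ,
      ∀ j, ∀ x ∈ S j, g x = γ j x := by
    intro γ hγ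
    refine ⟨unitBCF (fun x => if h : ∃ j, x ∈ S j then γ h.choose x else 0) fun x => ?_,
      fun j x hx => ?_⟩
    · split_ifs
      · exact hγ _ _
      · simp
    · have h : ∃ j, x ∈ S j := ⟨j, hx⟩
      have hj : h.choose = j := by
        by_contra hne
        exact Set.disjoint_left.1 (hS hne) h.choose_spec hx
      rw [unitBCF_apply, dif_pos h, hj]
  obtain ⟨g, hg⟩ := hglue α hα
  obtain ⟨h, hh⟩ := hglue β hβ
  refine ⟨mulOp g * C * mulOp h, mulOp_mul_mem hB_cb g h hCB, fun v x => ?_⟩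
  have h1 := (hC.hasSum_val (mulOp h v) x).const_smul (g x)
  rw [mul_apply_eq_comp, mul_apply_eq_comp, mulOp_apply_val]
  convert h1 using 2 with j
  have h2 : mulOp (ind (S j)) (mulOp h v) = mulOp (β j) v := by
    ext y
    rw [mulOp_apply_val, mulOp_apply_val, mulOp_apply_val, smul_smul]
    by_cases hy : y ∈ S j
    · rw [ind_of_mem hy, one_mul, hh j y hy]
    · rw [ind_of_notMem hy, zero_mul, hβS j y hy]
  rw [mul_apply_eq_comp, mul_apply_eq_comp, h2, mulOp_apply_val, smul_smul]
  by_cases hx : x ∈ S j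
  · rw [ind_of_mem hx, mul_one, hg j x hx]
  · rw [ind_of_notMem hx, mul_zero, hαS j x hx]

/-- For a uniformly bounded family of finite multiplicity, `∑ i, α i b β i` is an operator of finite
propagation in `B`. -/
theorem exists_hasSum_band [CompleteSpace E] (hX : BoundedGeometry X)
    {B : NonUnitalSubalgebra ℂ (BOp X E p)}
    (hB_cb : cbCb (B : Set (BOp X E p)) = B)
    (hB_cut : ClosedUnderBlockCutdowns (B : Set (BOp X E p))) {b : BOp X E p} (hb : b ∈ B)
    {I : Type u} {S : I → Set X} {D : ℝ} (hD : ∀ i, ∀ x ∈ S i, ∀ y ∈ S i, dist x y ≤ D)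
    {M : ℕ} (hM : ∀ x, {i | x ∈ S i}.encard ≤ M)
    {α β : I → X →ᵇ ℂ} (hα : ∀ j x, ‖α j x‖ ≤ 1) (hβ : ∀ j x, ‖β j x‖ ≤ 1)
    (hαS : ∀ j, ∀ x ∉ S j, α j x = 0) (hβS : ∀ j, ∀ x ∉ S j, β j x = 0) :
    ∃ T ∈ B, FinitePropagation T ∧ ∀ (v : Ell X E p) (x : X),
      HasSum (fun i => α i x • (b (mulOp (β i) v)).val x) ((T v).val x) := by
  classical
  obtain ⟨K, hK⟩ := hX.exists_encard_meeting_le hD hM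
  obtain ⟨c, hc, hcd⟩ := exists_colouring (fun i j => ¬ Disjoint (S i) (S j))
    (fun i j h h' => h h'.symm) K hK
  have hpiece : ∀ k : ℕ, ∃ T ∈ B, ∀ (v : Ell X E p) (x : X),
      HasSum (fun j : {i // c i = k} => α j x • (b (mulOp (β j) v)).val x) ((T v).val x) := by
    intro k
    refine exists_hasSum_of_disjoint hB_cb hB_cut hb (S := fun j : {i // c i = k} => S j) ?_
      (fun j => hα j) (fun j => hβ j) (fun j => hαS j) (fun j => hβS j)
    intro i j hij
    by_contra h
    exact hcd i j (fun h' => hij (Subtype.ext h')) h (i.2.trans j.2.symm)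
  choose T hTB hT using hpiece
  have hsum : ∀ (v : Ell X E p) (x : X), HasSum (fun i => α i x • (b (mulOp (β i) v)).val x)
      (((∑ k ∈ Finset.range (K + 1), T k) v).val x) := by
    intro v x
    have h1 : ∀ k, HasSum ({i | c i = k}.indicator fun i => α i x • (b (mulOp (β i) v)).val x)
        ((T k v).val x) := fun k => (hasSum_subtype_iff_indicator
          (s := {i | c i = k}) (f := fun i => α i x • (b (mulOp (β i) v)).val x)).1 (hT k v x)
    have h2 := hasSum_sum (s := Finset.range (K + 1)) fun k _ => h1 k
    rw [sum_apply, Ell.val_sum]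
    convert h2 using 2 with i
    rw [Finset.sum_eq_single (c i)]
    · rw [Set.indicator_of_mem (by simp)]
    · intro k _ hk
      exact Set.indicator_of_notMem (fun h => hk h.symm) _
    · intro h
      exact absurd (Finset.mem_range.2 (Nat.lt_succ_of_le (hc i))) h
  refine ⟨∑ k ∈ Finset.range (K + 1), T k, sum_mem fun k _ => hTB k, ?_, hsum⟩
  refine ⟨max D 0, le_max_right _ _, fun f f' hff' => ?_⟩
  ext v x
  rw [mul_apply_eq_comp, mul_apply_eq_comp, mulOp_apply_val]
  change f x • _ = 0
  by_cases hx : f x = 0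
  · rw [hx, zero_smul]
  have h1 := hsum (mulOp f' v) x
  have h2 : ∀ i, α i x • (b (mulOp (β i) (mulOp f' v))).val x = 0 := by
    intro i
    by_cases hxi : x ∈ S i
    · have h3 : mulOp (β i) (mulOp f' v) = 0 := by
        ext y
        rw [mulOp_apply_val, mulOp_apply_val, Ell.val_zero]
        by_cases hy : y ∈ S i
        · have h4 : f' y = 0 := by
            by_contra hne
            have := lt_dist_of_lt_setDist hff' (subset_tsupport _ hx) (subset_tsupport _ hne)
            exact absurd (hD i x hxi y hy) (not_le.2 ((le_max_left _ _).trans_lt this))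
          rw [h4, zero_smul, smul_zero]
        · rw [hβS i y hy, zero_smul]
      rw [h3, map_zero, Ell.val_zero, smul_zero]
    · rw [hαS i x hxi, zero_smul]
  simp only [h2] at h1
  rw [h1.unique hasSum_zero, smul_zero]

end Band

/-! ### The `p`-norm as a sum -/

section PNorm

variable {X : Type u} {E : Type v} [NormedAddCommGroup E] [NormedSpace ℂ E]
  {p : ℝ≥0∞} [Fact (p = 0 ∨ 1 ≤ p)]

theorem Ell.enorm_rpow_eq_tsum (hp : 1 ≤ p) (hp' : p ≠ ∞) (v : Ell X E p) :
    ‖v‖ₑ ^ p.toReal = ∑' x, ‖v.val x‖ₑ ^ p.toReal := by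
  have hp0 : p ≠ 0 := (zero_lt_one.trans_le hp).ne'
  have hq : 0 < p.toReal := ENNReal.toReal_pos hp0 hp'
  have hpe : (normExp p).toReal = p.toReal := by rw [normExp_of_ne_zero hp0]
  have h := lp.hasSum_norm (by rwa [hpe]) (v : lp (fun _ : X => E) (normExp p))
  rw [hpe] at h
  have h1 : ‖v‖ₑ ^ p.toReal = ENNReal.ofReal (‖v‖ ^ p.toReal) := by
    rw [← ofReal_norm, ENNReal.ofReal_rpow_of_nonneg (norm_nonneg _) hq.le]
  rw [h1]
  change ENNReal.ofReal (‖(v : lp (fun _ : X => E) (normExp p))‖ ^ p.toReal) = _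
  rw [← h.tsum_eq, ENNReal.ofReal_tsum_of_nonneg (fun _ => by positivity) h.summable]
  refine tsum_congr fun x => ?_
  rw [← ofReal_norm, ENNReal.ofReal_rpow_of_nonneg (norm_nonneg _) hq.le]
  rfl

end PNorm

/-! ### The exponents `0`, `1` and `∞` -/

section Endpoint

variable {X : Type u} [MetricSpace X] [DiscreteTopology X] {E : Type v} [NormedAddCommGroup E]
  [NormedSpace ℂ E] [CompleteSpace E] {p : ℝ≥0∞} [Fact (p = 0 ∨ 1 ≤ p)]

omit [DiscreteTopology X] in
theorem dist_le_of_mem_closedBall {x y z : X} {R : ℝ} (hx : x ∈ Metric.closedBall z R)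
    (hy : y ∈ Metric.closedBall z R) : dist x y ≤ 2 * R := by
  have h1 := dist_triangle_right x y z
  rw [Metric.mem_closedBall] at hx hy
  linarith

omit [DiscreteTopology X] in
theorem encard_mem_closedBall_le {R : ℝ} {N : ℕ}
    (hN : ∀ x : X, (Metric.closedBall x R).encard ≤ N) (x : X) :
    {i | x ∈ Metric.closedBall i R}.encard ≤ N := by
  convert hN x using 2
  ext i
  exact Metric.mem_closedBall_comm

/-- In the sup-norm, a quasi-local operator is approximated by its band truncations, since each row
can be estimated separately. -/
theorem QuasiLocal.mem_roe_of_sup (hX : BoundedGeometry X) (hp : normExp p = ∞)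
    {B : NonUnitalSubalgebra ℂ (BOp X E p)}
    (hB_cb : cbCb (B : Set (BOp X E p)) = B)
    (hB_cut : ClosedUnderBlockCutdowns (B : Set (BOp X E p))) {b : BOp X E p} (hb : b ∈ B)
    (hq : QuasiLocal b) : b ∈ roe (B : Set (BOp X E p)) := by
  refine Metric.mem_closure_iff.2 fun ε hε => ?_
  obtain ⟨R, -, hR⟩ := hq (ε / 2) (half_pos hε)
  obtain ⟨N, hN⟩ := hX R
  obtain ⟨T, hTB, hTf, hT⟩ := exists_hasSum_band hX hB_cb hB_cut hb
    (S := fun x : X => insert x (Metric.closedBall x R)) (D := 2 * |R|) (M := N + 1)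
    (α := fun x => ind {x}) (β := fun x => ind (Metric.closedBall x R))
    (by
      intro i x hx y hy
      have hsub : insert i (Metric.closedBall i R) ⊆ Metric.closedBall i |R| :=
        Set.insert_subset (Metric.mem_closedBall_self (abs_nonneg R))
          (Metric.closedBall_subset_closedBall (le_abs_self R))
      exact dist_le_of_mem_closedBall (hsub hx) (hsub hy))
    (by
      intro x
      have hsub : {i | x ∈ insert i (Metric.closedBall i R)} ⊆
          insert x {i | x ∈ Metric.closedBall i R} := by
        rintro i (rfl | hi)
        · exact Set.mem_insert _ _
        · exact Set.mem_insert_of_mem _ hi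
      refine (Set.encard_le_encard hsub).trans ((Set.encard_insert_le _ _).trans ?_)
      push_cast
      gcongr
      exact encard_mem_closedBall_le hN x)
    (fun _ => norm_ind_le _) (fun _ => norm_ind_le _)
    (fun i x hx => ind_of_notMem fun h => hx (Set.mem_insert_iff.2 (Or.inl h)))
    (fun i x hx => ind_of_notMem fun h => hx (Set.mem_insert_of_mem _ h))
  refine ⟨T, ⟨hTB, hTf⟩, ?_⟩
  rw [dist_eq_norm]
  refine lt_of_le_of_lt ?_ (half_lt_self hε)
  refine ContinuousLinearMap.opNorm_le_bound _ (half_pos hε).le fun v => ?_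
  refine Ell.norm_le_of_forall hp (by positivity) fun x => ?_
  have h1 : (T v).val x = (b (mulOp (ind (Metric.closedBall x R)) v)).val x := by
    refine (hT v x).unique ?_
    convert hasSum_single x fun i hi => ?_ using 1
    · rw [ind_of_mem (Set.mem_singleton x), one_smul]
    · rw [ind_of_notMem (fun h => hi (Set.mem_singleton_iff.1 h).symm), zero_smul]
  have h2 : ((b - T) v).val x =
      ((mulOp (ind {x}) * b * mulOp (ind (Metric.closedBall x R)ᶜ) : BOp X E p) v).val x := by
    rw [mul_apply_eq_comp, mul_apply_eq_comp, mulOp_ind_val_of_mem (Set.mem_singleton x),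
      ← one_sub_ind, mulOp_sub, mulOp_one, sub_apply, sub_apply, map_sub, Ell.val_sub,
      Ell.val_sub, h1]
    rfl
  rw [h2]
  refine (Ell.norm_val_le _ x).trans (ContinuousLinearMap.le_of_opNorm_le _ (hR _ _ ?_) v)
  rintro y rfl z hz
  rw [Set.mem_compl_iff, Metric.mem_closedBall, not_le] at hz
  rw [dist_comm]
  exact hz.le

/-- In the `1`-norm, a quasi-local operator is approximated by its band truncations, since each
column can be estimated separately. -/
theorem QuasiLocal.mem_roe_of_eq_one (hX : BoundedGeometry X) (hp : p = 1)
    {B : NonUnitalSubalgebra ℂ (BOp X E p)}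
    (hB_cb : cbCb (B : Set (BOp X E p)) = B)
    (hB_cut : ClosedUnderBlockCutdowns (B : Set (BOp X E p))) {b : BOp X E p} (hb : b ∈ B)
    (hq : QuasiLocal b) : b ∈ roe (B : Set (BOp X E p)) := by
  classical
  refine Metric.mem_closure_iff.2 fun ε hε => ?_
  obtain ⟨R, hR0, hR⟩ := hq (ε / 2) (half_pos hε)
  obtain ⟨N, hN⟩ := hX R
  obtain ⟨T, hTB, hTf, hT⟩ := exists_hasSum_band hX hB_cb hB_cut hb
    (S := fun x : X => Metric.closedBall x R) (D := 2 * R) (M := N)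
    (α := fun x => ind (Metric.closedBall x R)) (β := fun x => ind {x})
    (fun i x hx y hy => dist_le_of_mem_closedBall hx hy)
    (encard_mem_closedBall_le hN)
    (fun _ => norm_ind_le _) (fun _ => norm_ind_le _)
    (fun i x hx => ind_of_notMem hx)
    (fun i x hx => ind_of_notMem fun h => hx (by
      rw [Set.mem_singleton_iff.1 h]; exact Metric.mem_closedBall_self hR0.le))
  refine ⟨T, ⟨hTB, hTf⟩, ?_⟩
  rw [dist_eq_norm]
  refine lt_of_le_of_lt ?_ (half_lt_self hε)
  have hp1 : (1 : ℝ≥0∞) ≤ p := hp.ge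
  have hp' : p ≠ ∞ := by rw [hp]; exact ENNReal.one_ne_top
  have hq1 : p.toReal = 1 := by rw [hp]; simp
  have hcol : ∀ (x : X) (v : Ell X E p),
      ‖(b - T) (mulOp (ind {x}) v)‖ ≤ ε / 2 * ‖mulOp (ind {x}) v‖ := by
    intro x v
    have h1 : ∀ i, i ≠ x → mulOp (ind {i}) (mulOp (ind {x}) v) = 0 := by
      intro i hi
      ext y
      by_cases hy : y = i
      · rw [mulOp_apply_val, mulOp_ind_val_of_notMem (by rw [hy]; exact hi), smul_zero]
        rfl
      · rw [mulOp_ind_val_of_notMem (Set.notMem_singleton_iff.2 hy)]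
        rfl
    have h2 : mulOp (ind {x}) (mulOp (ind {x}) v) = mulOp (ind {x}) v := by
      rw [← mul_apply_eq_comp, ← mulOp_mul, mul_ind_eq_self fun y hy => ind_of_notMem hy]
    have h3 : (b - T) (mulOp (ind {x}) v) =
        (mulOp (ind (Metric.closedBall x R)ᶜ) * b * mulOp (ind {x}) : BOp X E p)
          (mulOp (ind {x}) v) := by
      ext y
      have h4 : (T (mulOp (ind {x}) v)).val y =
          ind (Metric.closedBall x R) y • (b (mulOp (ind {x}) v)).val y := by
        refine (hT _ y).unique ?_
        convert hasSum_single x fun i hi => ?_ using 1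
        · rw [h2]
        · rw [h1 i hi, map_zero, Ell.val_zero, smul_zero]
      rw [mul_apply_eq_comp, mul_apply_eq_comp, h2, sub_apply, Ell.val_sub, h4,
        ← one_sub_ind, mulOp_sub, mulOp_one, sub_apply, Ell.val_sub, mulOp_apply_val]
      rfl
    rw [h3]
    refine ContinuousLinearMap.le_of_opNorm_le _ (hR _ _ ?_) _
    rintro y hy z rfl
    rw [Set.mem_compl_iff, Metric.mem_closedBall, not_le] at hy
    exact hy.le
  have hnorm : ∀ (x : X) (v : Ell X E p), ‖mulOp (ind {x}) v‖ₑ = ‖v.val x‖ₑ := by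
    intro x v
    have h1 := Ell.enorm_rpow_eq_tsum hp1 hp' (mulOp (ind {x}) v)
    rw [hq1, ENNReal.rpow_one] at h1
    rw [h1, tsum_eq_single x]
    · rw [ENNReal.rpow_one, mulOp_ind_val_of_mem (Set.mem_singleton x)]
    · intro y hy
      rw [mulOp_ind_val_of_notMem (Set.notMem_singleton_iff.2 hy), enorm_zero, ENNReal.rpow_one]
  refine opNorm_le_of_finite_support hp' (half_pos hε).le fun v G hG => ?_
  have hv : v = ∑ x ∈ G, mulOp (ind {x}) v := by
    ext y
    rw [Ell.val_sum]
    by_cases hy : y ∈ G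
    · rw [Finset.sum_eq_single y, mulOp_ind_val_of_mem (Set.mem_singleton y)]
      · intro x _ hx
        exact mulOp_ind_val_of_notMem (fun h => hx (Set.mem_singleton_iff.1 h).symm) v
      · exact fun h => absurd hy h
    · rw [hG y hy, eq_comm]
      refine Finset.sum_eq_zero fun x hx => mulOp_ind_val_of_notMem (fun h => hy ?_) v
      rwa [Set.mem_singleton_iff.1 h]
  have hsum : ∑ x ∈ G, ‖mulOp (ind {x}) v‖ ≤ ‖v‖ := by
    have h1 := Ell.enorm_rpow_eq_tsum hp1 hp' v
    rw [hq1] at h1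
    simp only [ENNReal.rpow_one] at h1
    have h2 : ∑ x ∈ G, ‖mulOp (ind {x}) v‖ₑ ≤ ‖v‖ₑ := by
      rw [h1, Finset.sum_congr rfl fun x _ => hnorm x v]
      exact ENNReal.sum_le_tsum G
    simp only [← ofReal_norm] at h2
    rw [← ENNReal.ofReal_sum_of_nonneg fun _ _ => norm_nonneg _] at h2
    exact (ENNReal.ofReal_le_ofReal_iff (norm_nonneg v)).1 h2
  calc ‖(b - T) v‖ = ‖∑ x ∈ G, (b - T) (mulOp (ind {x}) v)‖ := by rw [← map_sum, ← hv]
    _ ≤ ∑ x ∈ G, ε / 2 * ‖mulOp (ind {x}) v‖ := norm_sum_le_of_le _ fun x _ => hcol x v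
    _ = ε / 2 * ∑ x ∈ G, ‖mulOp (ind {x}) v‖ := by rw [Finset.mul_sum]
    _ ≤ ε / 2 * ‖v‖ := by gcongr

end Endpoint

/-! ### Property A, Følner sets and metric sparsification -/

section Partition

variable {X : Type u} [MetricSpace X]

/-- A partition of unity whose members have supports of diameter at most `D` and multiplicity at most
`M`, with `ℓ¹`-variation at most `ε` at scale `r`. -/
structure IsUnitPartition {I : Type u} (D : ℝ) (M : ℕ) (r : ℝ) (ε : ℝ≥0∞) (μ : I → X → ℝ) :
    Prop where
  nonneg : ∀ i x, 0 ≤ μ i x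
  dist_le : ∀ i x y, μ i x ≠ 0 → μ i y ≠ 0 → dist x y ≤ D
  encard_le : ∀ x, {i | μ i x ≠ 0}.encard ≤ M
  hasSum : ∀ x, HasSum (fun i => μ i x) 1
  variation : ∀ x y, dist x y ≤ r → ∑' i, ENNReal.ofReal |μ i x - μ i y| ≤ ε

theorem IsUnitPartition.le_one {I : Type u} {D : ℝ} {M : ℕ} {r : ℝ} {ε : ℝ≥0∞} {μ : I → X → ℝ}
    (h : IsUnitPartition D M r ε μ) (i : I) (x : X) : μ i x ≤ 1 :=
  le_hasSum (h.hasSum x) i fun j _ => h.nonneg j x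

theorem IsUnitPartition.tsum_ofReal {I : Type u} {D : ℝ} {M : ℕ} {r : ℝ} {ε : ℝ≥0∞} {μ : I → X → ℝ}
    (h : IsUnitPartition D M r ε μ) (x : X) : ∑' i, ENNReal.ofReal (μ i x) = 1 := by
  rw [← ENNReal.ofReal_tsum_of_nonneg (fun i => h.nonneg i x) (h.hasSum x).summable,
    (h.hasSum x).tsum_eq, ENNReal.ofReal_one]

/-- If `a` and `b` differ by at most `δ` times the larger one, use Bernoulli's inequality; otherwise
both are at most `|a - b| / δ`. -/
theorem abs_rpow_sub_rpow_le {s δ a b : ℝ} (hs : 1 ≤ s) (hδ : 0 < δ) (hδ1 : δ ≤ 1) (ha : 0 ≤ a)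
    (hb : 0 ≤ b) : |a ^ s - b ^ s| ≤ s * δ * (a ^ s + b ^ s) + (|a - b| / δ) ^ s := by
  wlog hab : b ≤ a generalizing a b
  · rw [abs_sub_comm, abs_sub_comm a b, add_comm (a ^ s)]
    exact this hb ha (le_of_not_ge hab)
  have hs0 : 0 ≤ s := zero_le_one.trans hs
  have has : 0 ≤ a ^ s := Real.rpow_nonneg ha s
  have hbs : 0 ≤ b ^ s := Real.rpow_nonneg hb s
  rw [abs_of_nonneg (sub_nonneg.2 (Real.rpow_le_rpow hb hab hs0)), abs_of_nonneg (sub_nonneg.2 hab)]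
  have h0 : 0 ≤ ((a - b) / δ) ^ s := Real.rpow_nonneg (div_nonneg (sub_nonneg.2 hab) hδ.le) s
  by_cases h : a - b ≤ δ * a
  · have h1 : (1 - δ) * a ≤ b := by linarith
    have h2 : ((1 - δ) * a) ^ s ≤ b ^ s :=
      Real.rpow_le_rpow (mul_nonneg (sub_nonneg.2 hδ1) ha) h1 hs0
    rw [Real.mul_rpow (sub_nonneg.2 hδ1) ha] at h2
    have h3 := one_add_mul_self_le_rpow_one_add (s := -δ) (by linarith) hs
    have h4 : (1 + s * -δ) * a ^ s ≤ (1 + -δ) ^ s * a ^ s := by gcongr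
    rw [← sub_eq_add_neg] at h4
    have h5 : 0 ≤ s * δ * b ^ s := by positivity
    nlinarith
  · have h1 : a ≤ (a - b) / δ := by
      rw [le_div_iff₀ hδ]
      linarith
    have h2 : a ^ s ≤ ((a - b) / δ) ^ s := Real.rpow_le_rpow ha h1 hs0
    have h5 : 0 ≤ s * δ * (a ^ s + b ^ s) := by positivity
    linarith

/-- Property A, at whichever exponent it is given, yields partitions of unity of small
`ℓ¹`-variation. -/
theorem PropertyA.exists_isUnitPartition [DiscreteTopology X] (hA : PropertyA X) {r : ℝ} (hr : 0 < r)
    {ε : ℝ} (hε : 0 < ε) : ∃ (D : ℝ) (M : ℕ) (I : Type u) (μ : I → X → ℝ),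
      IsUnitPartition D M r (ENNReal.ofReal ε) μ := by
  obtain ⟨s, hs, hA⟩ := hA
  have hs0 : 0 < s := zero_lt_one.trans_le hs
  -- `δ` makes the first term of `abs_rpow_sub_rpow_le` at most `ε / 2` in total; the variation
  -- `δ * η` is then chosen for the second one, where `η ^ s ≤ η ≤ ε / 2`
  set δ := min 1 (ε / (4 * s))
  have hδ : 0 < δ := lt_min one_pos (by positivity)
  set η := min 1 (ε / 2)
  have hη : 0 < η := lt_min one_pos (by positivity)
  obtain ⟨I, φ, hφ, hvar⟩ := hA r hr (δ * η) (by positivity)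
  obtain ⟨D, hD⟩ := hφ.uniformly_bounded
  obtain ⟨M, hM⟩ := hφ.finite_multiplicity
  have hsupp : ∀ i x, φ i x ^ s ≠ 0 → x ∈ tsupport (φ i) := by
    intro i x h
    refine subset_tsupport _ fun h0 => h ?_
    rw [h0, Real.zero_rpow hs0.ne']
  refine ⟨D, M, I, fun i x => φ i x ^ s, ?_, ?_, ?_, hφ.hasSum_one, ?_⟩
  · exact fun i x => Real.rpow_nonneg (hφ.mem_Icc i x).1 s
  · exact fun i x y hx hy => hD i x (hsupp i x hx) y (hsupp i y hy)
  · exact fun x => (Set.encard_le_encard fun i hi => hsupp i x hi).trans (hM x)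
  · intro x y hxy
    have hfin : ∀ x, {i | x ∈ tsupport (φ i)}.Finite := fun x => Set.finite_of_encard_le_coe (hM x)
    have hsum : Summable fun i => |φ i x - φ i y| ^ s := by
      refine summable_of_hasFiniteSupport (((hfin x).union (hfin y)).subset fun i hi => ?_)
      by_contra hc
      rw [Set.mem_union, not_or] at hc
      refine hi ?_
      have h1 : φ i x = 0 := image_eq_zero_of_notMem_tsupport hc.1
      have h2 : φ i y = 0 := image_eq_zero_of_notMem_tsupport hc.2
      change |φ i x - φ i y| ^ s = 0
      rw [h1, h2, sub_self, abs_zero, Real.zero_rpow hs0.ne']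
    have hle : ∀ i, |φ i x ^ s - φ i y ^ s| ≤
        s * δ * (φ i x ^ s + φ i y ^ s) + (|φ i x - φ i y| ^ s) * (δ ^ s)⁻¹ := by
      intro i
      have := abs_rpow_sub_rpow_le hs hδ (min_le_left _ _) (hφ.mem_Icc i x).1 (hφ.mem_Icc i y).1
      rwa [Real.div_rpow (abs_nonneg _) hδ.le, div_eq_mul_inv] at this
    have hS : HasSum (fun i => s * δ * (φ i x ^ s + φ i y ^ s) +
        (|φ i x - φ i y| ^ s) * (δ ^ s)⁻¹)
        (s * δ * (1 + 1) + (∑' i, |φ i x - φ i y| ^ s) * (δ ^ s)⁻¹) :=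
      (((hφ.hasSum_one x).add (hφ.hasSum_one y)).mul_left _).add (hsum.hasSum.mul_right _)
    have hsmall : s * δ * (1 + 1) + (∑' i, |φ i x - φ i y| ^ s) * (δ ^ s)⁻¹ ≤ ε := by
      have h1 : s * δ * (1 + 1) ≤ ε / 2 := by
        have : δ ≤ ε / (4 * s) := min_le_right _ _
        rw [le_div_iff₀ (by positivity)] at this
        linarith
      have h2 : (∑' i, |φ i x - φ i y| ^ s) * (δ ^ s)⁻¹ ≤ η ^ s := by
        have h3 := (hvar x y hxy).le
        rw [Real.mul_rpow hδ.le hη.le] at h3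
        rw [← div_eq_mul_inv, div_le_iff₀ (Real.rpow_pos_of_pos hδ s)]
        linarith
      have h3 : η ^ s ≤ η := by
        have := Real.rpow_le_rpow_of_exponent_ge hη (min_le_left 1 (ε / 2)) hs
        rwa [Real.rpow_one] at this
      have h4 : η ≤ ε / 2 := min_le_right _ _
      linarith
    calc ∑' i, ENNReal.ofReal |φ i x ^ s - φ i y ^ s|
        ≤ ∑' i, ENNReal.ofReal (s * δ * (φ i x ^ s + φ i y ^ s) +
          (|φ i x - φ i y| ^ s) * (δ ^ s)⁻¹) :=
          ENNReal.tsum_le_tsum fun i => ENNReal.ofReal_le_ofReal (hle i)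
      _ = ENNReal.ofReal (s * δ * (1 + 1) + (∑' i, |φ i x - φ i y| ^ s) * (δ ^ s)⁻¹) := by
          rw [← ENNReal.ofReal_tsum_of_nonneg (fun i => (abs_nonneg _).trans (hle i)) hS.summable,
            hS.tsum_eq]
      _ ≤ ENNReal.ofReal ε := ENNReal.ofReal_le_ofReal hsmall

open MeasureTheory Classical in
/-- Følner sets for a finitely supported measure: among the superlevel sets of the members of a
partition of unity with small variation, one has relatively small `R`-boundary. The proof averages
over all members and all levels. -/
theorem IsUnitPartition.exists_folner (hX : BoundedGeometry X) {I : Type u} {D : ℝ} {M : ℕ} {R : ℝ}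
    {ε : ℝ≥0∞} {μ : I → X → ℝ} (hμ : IsUnitPartition D M R ε μ) {N : ℕ}
    (hN : ∀ x : X, (Metric.closedBall x R).encard ≤ N) {c : ℝ≥0∞} (hc : N * ε < c) (hc' : c ≠ ∞)
    (s : Finset X) (hs : s.Nonempty) (w : X → ℝ≥0∞) (hw0 : ∀ x ∈ s, w x ≠ 0)
    (hw : ∀ x ∈ s, w x ≠ ∞) :
    ∃ U : Set X, (∀ x ∈ U, ∀ y ∈ U, dist x y ≤ D) ∧ (∃ x ∈ s, x ∈ U) ∧
      ∑ x ∈ s with x ∈ U ∧ ∃ y, dist x y ≤ R ∧ y ∉ U, w x ≤ c * ∑ x ∈ s with x ∈ U, w x := by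
  let b : X → Finset X := fun x => (hX.finite_closedBall x R).toFinset
  have hb : ∀ x y, y ∈ b x ↔ dist x y ≤ R := by
    intro x y
    simp [b, dist_comm]
  have hbN : ∀ x, ((b x).card : ℝ≥0∞) ≤ N := by
    intro x
    have := hN x
    rw [(hX.finite_closedBall x R).encard_eq_coe_toFinset_card, Nat.cast_le] at this
    exact_mod_cast this
  -- `G i t` is the mass of the superlevel set `{t < μ i}`, and `F i t` dominates that of its boundary;
  -- the lower bound `0 ≤ t` makes `G i t` vanish at the irrelevant negative levels
  let G : I → ℝ → ℝ≥0∞ := fun i t => ∑ x ∈ s, w x * (Set.Ico 0 (μ i x)).indicator 1 t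
  let F : I → ℝ → ℝ≥0∞ := fun i t =>
    ∑ x ∈ s, ∑ y ∈ b x, w x * (Set.Ico (μ i y) (μ i x)).indicator 1 t
  have hmeas : ∀ a b : ℝ, Measurable ((Set.Ico a b).indicator (1 : ℝ → ℝ≥0∞)) := fun a b =>
    measurable_one.indicator measurableSet_Ico
  have hint : ∀ a b : ℝ, ∫⁻ t, (Set.Ico a b).indicator (1 : ℝ → ℝ≥0∞) t = ENNReal.ofReal (b - a) := by
    intro a b
    rw [lintegral_indicator_one measurableSet_Ico, Real.volume_Ico]
  have hGint : ∀ i, ∫⁻ t, G i t = ∑ x ∈ s, w x * ENNReal.ofReal (μ i x) := by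
    intro i
    rw [lintegral_finsetSum _ fun x _ => (hmeas _ _).const_mul _]
    refine Finset.sum_congr rfl fun x _ => ?_
    rw [lintegral_const_mul _ (hmeas _ _), hint, sub_zero]
  have hFint : ∀ i, ∫⁻ t, F i t = ∑ x ∈ s, ∑ y ∈ b x, w x * ENNReal.ofReal (μ i x - μ i y) := by
    intro i
    rw [lintegral_finsetSum _ fun x _ => Finset.measurable_sum _ fun y _ => (hmeas _ _).const_mul _]
    refine Finset.sum_congr rfl fun x _ => ?_
    rw [lintegral_finsetSum _ fun y _ => (hmeas _ _).const_mul _]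
    refine Finset.sum_congr rfl fun y _ => ?_
    rw [lintegral_const_mul _ (hmeas _ _), hint]
  -- summed over `i` and integrated over `t`, the masses give the total mass, and the boundaries at
  -- most `N * ε` times that
  obtain ⟨i, t, hit⟩ : ∃ i t, F i t < c * G i t := by
    by_contra! H
    have h1 : ∀ i, c * ∑ x ∈ s, w x * ENNReal.ofReal (μ i x) ≤
        ∑ x ∈ s, ∑ y ∈ b x, w x * ENNReal.ofReal |μ i x - μ i y| := by
      intro i
      rw [← hGint, ← lintegral_const_mul' _ _ hc']
      refine (lintegral_mono fun t => H i t).trans ?_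
      rw [hFint]
      gcongr
      exact le_abs_self _
    have h2 := ENNReal.tsum_le_tsum h1
    rw [ENNReal.tsum_mul_left, Summable.tsum_finsetSum fun _ _ => ENNReal.summable,
      Summable.tsum_finsetSum fun _ _ => ENNReal.summable] at h2
    have h3 : ∑ x ∈ s, ∑' i, ∑ y ∈ b x, w x * ENNReal.ofReal |μ i x - μ i y| ≤
        N * ε * ∑ x ∈ s, w x := by
      rw [Finset.mul_sum]
      refine Finset.sum_le_sum fun x _ => ?_
      rw [Summable.tsum_finsetSum fun _ _ => ENNReal.summable]
      calc ∑ y ∈ b x, ∑' i, w x * ENNReal.ofReal |μ i x - μ i y| ≤ ∑ y ∈ b x, w x * ε := by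
            refine Finset.sum_le_sum fun y hy => ?_
            rw [ENNReal.tsum_mul_left]
            gcongr
            exact hμ.variation x y ((hb x y).1 hy)
        _ = (b x).card * (w x * ε) := by rw [Finset.sum_const, nsmul_eq_mul]
        _ ≤ N * (w x * ε) := by exact mul_le_mul_left (hbN x) _
        _ = N * ε * w x := by ring
    have h4 : ∑ x ∈ s, ∑' i, w x * ENNReal.ofReal (μ i x) = ∑ x ∈ s, w x :=
      Finset.sum_congr rfl fun x _ => by rw [ENNReal.tsum_mul_left, hμ.tsum_ofReal, mul_one]
    rw [h4] at h2
    have h5 : ∑ x ∈ s, w x ≠ 0 := by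
      obtain ⟨x, hx⟩ := hs
      exact fun h => hw0 x hx (Finset.sum_eq_zero_iff.1 h x hx)
    have h6 : ∑ x ∈ s, w x ≠ ∞ := ENNReal.sum_ne_top.2 hw
    exact absurd (h2.trans h3) (not_le.2 (ENNReal.mul_lt_mul_left h5 h6 hc))
  have ht : 0 ≤ t := by
    by_contra ht
    have : G i t = 0 := Finset.sum_eq_zero fun x _ => by
      rw [Set.indicator_of_notMem fun h => ht h.1, mul_zero]
    rw [this, mul_zero] at hit
    exact absurd hit not_lt_zero
  have hG : G i t = ∑ x ∈ s with x ∈ {x | t < μ i x}, w x := by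
    rw [Finset.sum_filter]
    refine Finset.sum_congr rfl fun x _ => ?_
    by_cases hx : t < μ i x
    · rw [if_pos (show x ∈ {x | t < μ i x} from hx), Set.indicator_of_mem (Set.mem_Ico.2 ⟨ht, hx⟩),
        Pi.one_apply, mul_one]
    · rw [if_neg (show x ∉ {x | t < μ i x} from hx), Set.indicator_of_notMem fun h => hx h.2,
        mul_zero]
  refine ⟨{x | t < μ i x}, fun x hx y hy => ?_, ?_, ?_⟩
  · exact hμ.dist_le i x y (ht.trans_lt hx).ne' (ht.trans_lt hy).ne'
  · by_contra! h
    rw [hG, Finset.filter_false_of_mem h, Finset.sum_empty, mul_zero] at hit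
    exact absurd hit not_lt_zero
  · rw [← hG]
    refine le_trans ?_ hit.le
    rw [Finset.sum_filter]
    refine Finset.sum_le_sum fun x _ => ?_
    split_ifs with hx
    · obtain ⟨hx, y, hxy, hy⟩ := hx
      rw [Set.mem_ofPred_eq] at hx
      rw [Set.mem_ofPred_eq, not_lt] at hy
      refine le_trans ?_ (Finset.single_le_sum
        (f := fun y => w x * (Set.Ico (μ i y) (μ i x)).indicator 1 t) (fun _ _ => bot_le)
        ((hb x y).2 hxy))
      rw [Set.indicator_of_mem (Set.mem_Ico.2 ⟨hy, hx⟩), Pi.one_apply, mul_one]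
    · exact bot_le

open Classical in
/-- Metric sparsification: up to a fraction `c` of the mass, a finitely supported measure lives on a
union of pieces of uniformly bounded diameter whose mutual distances exceed `R`. The pieces are
obtained by removing Følner sets one after the other, and keeping their `R`-interiors. -/
theorem IsUnitPartition.exists_sparse (hX : BoundedGeometry X) {I : Type u} {D : ℝ} {M : ℕ} {R : ℝ}
    {ε : ℝ≥0∞} {μ : I → X → ℝ} (hμ : IsUnitPartition D M R ε μ) {N : ℕ}
    (hN : ∀ x : X, (Metric.closedBall x R).encard ≤ N) {c : ℝ≥0∞} (hc : N * ε < c) (hc' : c ≠ ∞)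
    (w : X → ℝ≥0∞) (s : Finset X) (hw0 : ∀ x ∈ s, w x ≠ 0) (hw : ∀ x ∈ s, w x ≠ ∞) :
    ∃ P : Finset (Finset X), (∀ A ∈ P, A ⊆ s ∧ ∀ x ∈ A, ∀ y ∈ A, dist x y ≤ D) ∧
      (∀ A ∈ P, ∀ A' ∈ P, A ≠ A' → ∀ x ∈ A, ∀ y ∈ A', R < dist x y) ∧
      ∑ x ∈ s \ P.biUnion id, w x ≤ c * ∑ x ∈ s, w x := by
  induction s using Finset.strongInduction with
  | H s ih =>
    rcases s.eq_empty_or_nonempty with rfl | hs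
    · exact ⟨∅, by simp, by simp, by simp⟩
    obtain ⟨U, hUD, ⟨x₀, hx₀, hx₀U⟩, hU⟩ := hμ.exists_folner hX hN hc hc' s hs w hw0 hw
    -- outside of `U` the induction hypothesis applies; inside, keep the `R`-interior `A₀` of `U`
    set s' := s.filter fun x => x ∉ U with hs'
    have hss : s' ⊂ s := by
      refine (Finset.ssubset_iff_of_subset (Finset.filter_subset _ _)).2 ⟨x₀, hx₀, ?_⟩
      simp [hx₀U]
    obtain ⟨P, hP, hPd, hPw⟩ := ih s' hss (fun x hx => hw0 x (hss.1 hx)) (fun x hx => hw x (hss.1 hx))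
    set A₀ := s.filter fun x => x ∈ U ∧ ∀ y, dist x y ≤ R → y ∈ U with hA₀
    have hfar : ∀ A ∈ P, ∀ x ∈ A₀, ∀ y ∈ A, R < dist x y := by
      intro A hA x hx y hy
      by_contra! h
      have h1 := (Finset.mem_filter.1 hx).2.2 y h
      exact (Finset.mem_filter.1 ((hP A hA).1 hy)).2 h1
    refine ⟨insert A₀ P, ?_, ?_, ?_⟩
    · intro A hA
      rcases Finset.mem_insert.1 hA with rfl | hA
      · exact ⟨Finset.filter_subset _ _, fun x hx y hy =>
          hUD x (Finset.mem_filter.1 hx).2.1 y (Finset.mem_filter.1 hy).2.1⟩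
      · exact ⟨(hP A hA).1.trans hss.1, (hP A hA).2⟩
    · intro A hA A' hA' hne x hx y hy
      rcases Finset.mem_insert.1 hA with rfl | hA <;> rcases Finset.mem_insert.1 hA' with rfl | hA'
      · exact absurd rfl hne
      · exact hfar A' hA' x hx y hy
      · rw [dist_comm]
        exact hfar A hA y hy x hx
      · exact hPd A hA A' hA' hne x hx y hy
    · have hsub : s \ (insert A₀ P).biUnion id ⊆
          (s' \ P.biUnion id) ∪ s.filter fun x => x ∈ U ∧ ∃ y, dist x y ≤ R ∧ y ∉ U := by
        intro x hx
        rw [Finset.mem_sdiff, Finset.biUnion_insert, Finset.mem_union, not_or] at hx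
        obtain ⟨hxs, hx1, hx2⟩ := hx
        rw [Finset.mem_union]
        by_cases hxU : x ∈ U
        · refine Or.inr (Finset.mem_filter.2 ⟨hxs, hxU, ?_⟩)
          by_contra! h
          exact hx1 (Finset.mem_filter.2 ⟨hxs, hxU, h⟩)
        · exact Or.inl (Finset.mem_sdiff.2 ⟨Finset.mem_filter.2 ⟨hxs, hxU⟩, hx2⟩)
      calc ∑ x ∈ s \ (insert A₀ P).biUnion id, w x
          ≤ ∑ x ∈ s' \ P.biUnion id, w x +
            ∑ x ∈ s with x ∈ U ∧ ∃ y, dist x y ≤ R ∧ y ∉ U, w x :=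
            (Finset.sum_le_sum_of_subset hsub).trans (le_self_add.trans_eq Finset.sum_union_inter)
        _ ≤ c * ∑ x ∈ s', w x + c * ∑ x ∈ s with x ∈ U, w x := add_le_add hPw hU
        _ = c * ∑ x ∈ s, w x := by
            rw [← mul_add, add_comm, hs', Finset.sum_filter_add_sum_filter_not]

end Partition

/-! ### Hölder pairs -/

section HolderPair

variable {X : Type u} [MetricSpace X]

/-- A pair of families with `∑ i, α i β i = 1`, where `(α i x)` and `(β i x)` lie in the unit balls of
`ℓ^q'` and `ℓ^q` for conjugate exponents, and where `x ↦ (β i x)` has small variation in `ℓ^q` at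
scale `r`. -/
structure IsHolderPair (q q' : ℝ) {I : Type u} (D : ℝ) (M : ℕ) (r : ℝ) (κ : ℝ≥0∞)
    (α β : I → X →ᵇ ℂ) : Prop where
  conj : q.HolderConjugate q'
  norm_left_le : ∀ i x, ‖α i x‖ ≤ 1
  norm_right_le : ∀ i x, ‖β i x‖ ≤ 1
  left_eq_zero : ∀ i x, β i x = 0 → α i x = 0
  dist_le : ∀ i x y, β i x ≠ 0 → β i y ≠ 0 → dist x y ≤ D
  encard_le : ∀ x, {i | β i x ≠ 0}.encard ≤ M
  hasSum : ∀ x, HasSum (fun i => α i x * β i x) 1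
  tsum_left_le : ∀ x, ∑' i, ‖α i x‖ₑ ^ q' ≤ 1
  tsum_right_le : ∀ x, ∑' i, ‖β i x‖ₑ ^ q ≤ 1
  variation : ∀ x y, dist x y ≤ r → ∑' i, ‖β i x - β i y‖ₑ ^ q ≤ κ
  variation_le_two : ∀ x y, ∑' i, ‖β i x - β i y‖ₑ ^ q ≤ 2

/-- Subadditivity of `t ↦ t ^ (1 / q)`, raised to the power `q`. -/
theorem abs_rpow_inv_sub_rpow_inv_le {q a b : ℝ} (hq : 1 < q) (ha : 0 ≤ a) (hb : 0 ≤ b) :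
    |a ^ q⁻¹ - b ^ q⁻¹| ^ q ≤ |a - b| := by
  wlog hab : b ≤ a generalizing a b
  · rw [abs_sub_comm, abs_sub_comm a b]
    exact this hb ha (le_of_not_ge hab)
  have hq0 : 0 < q := zero_lt_one.trans hq
  have hqi : 0 ≤ q⁻¹ := inv_nonneg.2 hq0.le
  rw [abs_of_nonneg (sub_nonneg.2 (Real.rpow_le_rpow hb hab hqi)), abs_of_nonneg (sub_nonneg.2 hab)]
  have h1 : a ^ q⁻¹ ≤ (a - b) ^ q⁻¹ + b ^ q⁻¹ := by
    have := Real.rpow_add_le_add_rpow (sub_nonneg.2 hab) hb hqi (inv_le_one_of_one_le₀ hq.le)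
    rwa [sub_add_cancel] at this
  calc (a ^ q⁻¹ - b ^ q⁻¹) ^ q ≤ ((a - b) ^ q⁻¹) ^ q :=
        Real.rpow_le_rpow (sub_nonneg.2 (Real.rpow_le_rpow hb hab hqi)) (by linarith) hq0.le
    _ = a - b := Real.rpow_inv_rpow (sub_nonneg.2 hab) hq0.ne'

theorem enorm_ofReal_rpow {a e : ℝ} (ha : 0 ≤ a) (he : 0 ≤ e) :
    ‖(a : ℂ)‖ₑ ^ e = ENNReal.ofReal (a ^ e) := by
  rw [← ofReal_norm, Complex.norm_real, Real.norm_eq_abs, abs_of_nonneg ha,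
    ENNReal.ofReal_rpow_of_nonneg ha he]

/-- From a partition of unity `μ`, take `β = μ ^ (1 / q)` and `α = μ ^ (1 / q')`. -/
theorem IsUnitPartition.exists_isHolderPair [DiscreteTopology X] {I : Type u} {D : ℝ} {M : ℕ} {r : ℝ}
    {κ : ℝ≥0∞} {μ : I → X → ℝ} (hμ : IsUnitPartition D M r κ μ) {q : ℝ} (hq : 1 < q) :
    ∃ (q' : ℝ) (α β : I → X →ᵇ ℂ), IsHolderPair q q' D M r κ α β := by
  have hpow : ∀ e : ℝ, 0 ≤ e → ∀ i x, ‖((μ i x ^ e : ℝ) : ℂ)‖ ≤ 1 := by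
    intro e he i x
    rw [Complex.norm_real, Real.norm_eq_abs, abs_of_nonneg (Real.rpow_nonneg (hμ.nonneg i x) e)]
    exact Real.rpow_le_one (hμ.nonneg i x) (hμ.le_one i x) he
  obtain ⟨q', hqq⟩ : ∃ q', q.HolderConjugate q' := ⟨_, Real.HolderConjugate.conjExponent hq⟩
  have hq0 : 0 < q := hqq.pos
  have hq0' : 0 < q' := hqq.symm.pos
  have hqi : 0 ≤ q⁻¹ := inv_nonneg.2 hq0.le
  have hqi' : 0 ≤ q'⁻¹ := inv_nonneg.2 hq0'.le
  have hzero : ∀ i x (e : ℝ), 0 < e → ((((μ i x) ^ e : ℝ) : ℂ) = 0 ↔ μ i x = 0) := by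
    intro i x e he
    rw [Complex.ofReal_eq_zero, Real.rpow_eq_zero_iff_of_nonneg (hμ.nonneg i x)]
    exact ⟨fun h => h.1, fun h => ⟨h, he.ne'⟩⟩
  have hz := fun i x => hzero i x q⁻¹ (inv_pos.2 hq0)
  have hz' := fun i x => hzero i x q'⁻¹ (inv_pos.2 hq0')
  have hvar : ∀ x y, ∑' i, ‖((μ i x ^ q⁻¹ : ℝ) : ℂ) - ((μ i y ^ q⁻¹ : ℝ) : ℂ)‖ₑ ^ q ≤
      ∑' i, ENNReal.ofReal |μ i x - μ i y| := by
    intro x y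
    refine ENNReal.tsum_le_tsum fun i => ?_
    rw [← Complex.ofReal_sub, ← ofReal_norm, Complex.norm_real, Real.norm_eq_abs,
      ENNReal.ofReal_rpow_of_nonneg (abs_nonneg _) hq0.le]
    exact ENNReal.ofReal_le_ofReal (abs_rpow_inv_sub_rpow_inv_le hq (hμ.nonneg i x) (hμ.nonneg i y))
  refine ⟨q', fun i => unitBCF _ (hpow q'⁻¹ hqi' i), fun i => unitBCF _ (hpow q⁻¹ hqi i), hqq,
    fun i => hpow q'⁻¹ hqi' i, fun i => hpow q⁻¹ hqi i, fun i x h => ?_, fun i x y hx hy => ?_,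
    fun x => ?_, fun x => ?_, fun x => ?_, fun x => ?_, fun x y h => ?_, fun x y => ?_⟩
  · exact (hz' i x).2 ((hz i x).1 h)
  · exact hμ.dist_le i x y (fun h => hx ((hz i x).2 h)) (fun h => hy ((hz i y).2 h))
  · refine (Set.encard_le_encard (t := {i | μ i x ≠ 0}) fun i hi => ?_).trans (hμ.encard_le x)
    exact fun h => (show (((μ i x) ^ q⁻¹ : ℝ) : ℂ) ≠ 0 from hi) ((hz i x).2 h)
  · simp only [unitBCF_apply]
    have h1 := (Complex.hasSum_ofReal (f := fun i => μ i x) (x := 1)).2 (hμ.hasSum x)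
    rw [Complex.ofReal_one] at h1
    convert h1 using 2 with i
    rw [← Complex.ofReal_mul, ← Real.rpow_add_of_nonneg (hμ.nonneg i x) hqi' hqi, add_comm,
      hqq.inv_add_inv_eq_one, Real.rpow_one]
  · refine le_of_eq ?_
    rw [← hμ.tsum_ofReal x]
    refine tsum_congr fun i => ?_
    rw [unitBCF_apply, enorm_ofReal_rpow (Real.rpow_nonneg (hμ.nonneg i x) _) hq0'.le,
      Real.rpow_inv_rpow (hμ.nonneg i x) hq0'.ne']
  · refine le_of_eq ?_
    rw [← hμ.tsum_ofReal x]
    refine tsum_congr fun i => ?_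
    rw [unitBCF_apply, enorm_ofReal_rpow (Real.rpow_nonneg (hμ.nonneg i x) _) hq0.le,
      Real.rpow_inv_rpow (hμ.nonneg i x) hq0.ne']
  · exact (hvar x y).trans (hμ.variation x y h)
  · refine (hvar x y).trans ?_
    calc ∑' i, ENNReal.ofReal |μ i x - μ i y|
        ≤ ∑' i, (ENNReal.ofReal (μ i x) + ENNReal.ofReal (μ i y)) := by
          refine ENNReal.tsum_le_tsum fun i => ?_
          have hx := hμ.nonneg i x
          have hy := hμ.nonneg i y
          rw [← ENNReal.ofReal_add hx hy]
          refine ENNReal.ofReal_le_ofReal (abs_le.2 ⟨?_, ?_⟩) <;> linarith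
      _ = 2 := by
          rw [ENNReal.tsum_add, hμ.tsum_ofReal, hμ.tsum_ofReal, one_add_one_eq_two]

theorem tsum_mul_le_of_holderConjugate {ι : Type*} {q q' : ℝ} (hq : q'.HolderConjugate q)
    (f g : ι → ℝ≥0∞) :
    ∑' i, f i * g i ≤ (∑' i, f i ^ q') ^ (1 / q') * (∑' i, g i ^ q) ^ (1 / q) := by
  refine ENNReal.summable.tsum_le_of_sum_le fun s => ?_
  refine (ENNReal.inner_le_Lp_mul_Lq s f g hq).trans ?_
  have h1 : 0 ≤ 1 / q' := one_div_nonneg.2 hq.nonneg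
  have h2 : 0 ≤ 1 / q := one_div_nonneg.2 hq.symm.nonneg
  gcongr <;> exact ENNReal.sum_le_tsum s

end HolderPair

/-! ### Estimates for band operators -/

section Estimates

variable {X : Type u} [MetricSpace X] {E : Type v} [NormedAddCommGroup E] [NormedSpace ℂ E]
  {p : ℝ≥0∞} [Fact (p = 0 ∨ 1 ≤ p)]

/-- If the `ℓ^p`-norms of the families `(ψ i x)` are bounded by `κ` on the support of `v`, then the
norms of the vectors `ψ i v` are `p`-summable. -/
theorem tsum_enorm_mulOp_rpow_le (hp : 1 ≤ p) (hp' : p ≠ ∞) {I : Type*} (ψ : I → X →ᵇ ℂ)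
    (v : Ell X E p) {κ : ℝ≥0∞} (h : ∀ x, v.val x ≠ 0 → ∑' i, ‖ψ i x‖ₑ ^ p.toReal ≤ κ) :
    ∑' i, ‖mulOp (ψ i) v‖ₑ ^ p.toReal ≤ κ * ‖v‖ₑ ^ p.toReal := by
  have hq : 0 < p.toReal := ENNReal.toReal_pos (zero_lt_one.trans_le hp).ne' hp'
  simp only [Ell.enorm_rpow_eq_tsum hp hp']
  rw [ENNReal.tsum_comm, ← ENNReal.tsum_mul_left]
  refine ENNReal.tsum_le_tsum fun x => ?_
  simp only [mulOp_apply_val, enorm_smul, ENNReal.mul_rpow_of_nonneg _ _ hq.le]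
  rw [ENNReal.tsum_mul_right]
  by_cases hx : v.val x = 0
  · rw [hx, enorm_zero, ENNReal.zero_rpow_of_pos hq, mul_zero, mul_zero]
  · gcongr
    exact h x hx

/-- Hölder's inequality for `w = ∑ i, α i u i`. -/
theorem IsHolderPair.enorm_rpow_le (hp : 1 ≤ p) (hp' : p ≠ ∞) {q' : ℝ} {I : Type u} {D : ℝ} {M : ℕ}
    {r : ℝ} {κ : ℝ≥0∞} {α β : I → X →ᵇ ℂ} (h : IsHolderPair p.toReal q' D M r κ α β)
    {w : Ell X E p} {u : I → Ell X E p}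
    (hw : ∀ x, HasSum (fun i => α i x • (u i).val x) (w.val x)) :
    ‖w‖ₑ ^ p.toReal ≤ ∑' i, ‖u i‖ₑ ^ p.toReal := by
  have hq := h.conj.pos
  simp only [Ell.enorm_rpow_eq_tsum hp hp']
  rw [ENNReal.tsum_comm]
  refine ENNReal.tsum_le_tsum fun x => ?_
  have h1 : ‖w.val x‖ₑ ≤ (∑' i, ‖(u i).val x‖ₑ ^ p.toReal) ^ (1 / p.toReal) :=
    calc ‖w.val x‖ₑ ≤ ∑' i, ‖α i x • (u i).val x‖ₑ := by
          rw [← (hw x).tsum_eq]; exact enorm_tsum_le_tsum_enorm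
      _ = ∑' i, ‖α i x‖ₑ * ‖(u i).val x‖ₑ := by simp only [enorm_smul]
      _ ≤ (∑' i, ‖α i x‖ₑ ^ q') ^ (1 / q') * (∑' i, ‖(u i).val x‖ₑ ^ p.toReal) ^ (1 / p.toReal) :=
          tsum_mul_le_of_holderConjugate h.conj.symm _ _
      _ ≤ 1 * (∑' i, ‖(u i).val x‖ₑ ^ p.toReal) ^ (1 / p.toReal) := by
          gcongr
          exact ENNReal.rpow_le_one (h.tsum_left_le x) (one_div_nonneg.2 h.conj.symm.nonneg)
      _ = _ := one_mul _
  calc ‖w.val x‖ₑ ^ p.toReal ≤ ((∑' i, ‖(u i).val x‖ₑ ^ p.toReal) ^ (1 / p.toReal)) ^ p.toReal := by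
        gcongr
    _ = _ := by rw [← ENNReal.rpow_mul, one_div, inv_mul_cancel₀ hq.ne', ENNReal.rpow_one]

theorem norm_le_of_enorm_rpow_le {q : ℝ} (hq : 0 < q) {F : Type*} [NormedAddCommGroup F] {v w : F}
    {C : ℝ} (hC : 0 ≤ C) (h : ‖w‖ₑ ^ q ≤ ENNReal.ofReal C ^ q * ‖v‖ₑ ^ q) : ‖w‖ ≤ C * ‖v‖ := by
  rw [← ENNReal.mul_rpow_of_nonneg _ _ hq.le, ENNReal.rpow_le_rpow_iff hq, ← ofReal_norm,
    ← ofReal_norm, ← ENNReal.ofReal_mul hC, ENNReal.ofReal_le_ofReal_iff (by positivity)] at h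
  exact h

omit [MetricSpace X] in
theorem enorm_apply_le (a : BOp X E p) (v : Ell X E p) : ‖a v‖ₑ ≤ ENNReal.ofReal ‖a‖ * ‖v‖ₑ := by
  rw [← ofReal_norm, ← ofReal_norm, ← ENNReal.ofReal_mul (norm_nonneg a)]
  exact ENNReal.ofReal_le_ofReal (a.le_opNorm v)

/-- The compressions of `T = ∑ i, α i b β i` are bounded by those of `b`. -/
theorem IsHolderPair.norm_compression_le (hp : 1 ≤ p) (hp' : p ≠ ∞) {q' : ℝ} {I : Type u} {D : ℝ}
    {M : ℕ} {r : ℝ} {κ : ℝ≥0∞} {α β : I → X →ᵇ ℂ} (h : IsHolderPair p.toReal q' D M r κ α β)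
    {b T : BOp X E p} (hT : ∀ (v : Ell X E p) (x : X),
      HasSum (fun i => α i x • (b (mulOp (β i) v)).val x) ((T v).val x)) (f g : X →ᵇ ℂ) :
    ‖mulOp f * T * mulOp g‖ ≤ ‖mulOp f * b * mulOp g‖ := by
  have hq := h.conj.pos
  refine ContinuousLinearMap.opNorm_le_bound _ (norm_nonneg (mulOp f * b * mulOp g)) fun v => ?_
  refine norm_le_of_enorm_rpow_le hq (norm_nonneg _) ?_
  have h1 := h.enorm_rpow_le hp hp' (w := (mulOp f * T * mulOp g : BOp X E p) v)
    (u := fun i => (mulOp f * b * mulOp g : BOp X E p) (mulOp (β i) v)) (fun x => by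
      have h2 := (hT (mulOp g v) x).const_smul (f x)
      rw [mul_apply_eq_comp, mul_apply_eq_comp, mulOp_apply_val]
      convert h2 using 2 with i
      have h3 : mulOp (β i) (mulOp g v) = mulOp g (mulOp (β i) v) := by
        rw [← mul_apply_eq_comp, mulOp_comm, mul_apply_eq_comp]
      rw [h3, mul_apply_eq_comp, mul_apply_eq_comp, mulOp_apply_val, smul_comm])
  refine h1.trans ?_
  calc ∑' i, ‖(mulOp f * b * mulOp g : BOp X E p) (mulOp (β i) v)‖ₑ ^ p.toReal
      ≤ ∑' i, (ENNReal.ofReal ‖mulOp f * b * mulOp g‖ * ‖mulOp (β i) v‖ₑ) ^ p.toReal := by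
        gcongr
        exact enorm_apply_le _ _
    _ = ENNReal.ofReal ‖mulOp f * b * mulOp g‖ ^ p.toReal * ∑' i, ‖mulOp (β i) v‖ₑ ^ p.toReal := by
        simp only [ENNReal.mul_rpow_of_nonneg _ _ hq.le]
        rw [ENNReal.tsum_mul_left]
    _ ≤ ENNReal.ofReal ‖mulOp f * b * mulOp g‖ ^ p.toReal * (1 * ‖v‖ₑ ^ p.toReal) := by
        gcongr
        exact tsum_enorm_mulOp_rpow_le hp hp' β v fun x _ => h.tsum_right_le x
    _ = _ := by rw [one_mul]

theorem add_add_rpow_le {q : ℝ} (hq : 0 < q) (a b c : ℝ≥0∞) :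
    (a + b + c) ^ q ≤ 3 ^ q * (a ^ q + b ^ q + c ^ q) := by
  set m := max a (max b c) with hm
  have ha : a ≤ m := le_max_left _ _
  have hb : b ≤ m := (le_max_left _ _).trans (le_max_right _ _)
  have hc : c ≤ m := (le_max_right _ _).trans (le_max_right _ _)
  have h1 : a + b + c ≤ 3 * m :=
    calc a + b + c ≤ m + m + m := by gcongr
      _ = 3 * m := by ring
  have h2 : m ^ q ≤ a ^ q + b ^ q + c ^ q := by
    rcases max_choice a (max b c) with h | h
    · rw [hm, h, add_assoc]; exact le_self_add
    · rcases max_choice b c with h' | h'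
      · rw [hm, h, h', add_comm (a ^ q), add_assoc]; exact le_self_add
      · rw [hm, h, h']; exact le_add_self
  calc (a + b + c) ^ q ≤ (3 * m) ^ q := by gcongr
    _ = 3 ^ q * m ^ q := ENNReal.mul_rpow_of_nonneg _ _ hq.le
    _ ≤ _ := by gcongr

variable [DiscreteTopology X]

/-- On vectors supported in a ball `F`, the operator `b - ∑ i, α i b β i` is small: there
`(b - T) v = ∑ i, α i [β i - β i x₀, b] v`, and the functions `β i` are nearly constant on the
neighbourhood of `F` on which `b v` is concentrated. -/
theorem IsHolderPair.enorm_sub_apply_rpow_le (hp : 1 ≤ p) (hp' : p ≠ ∞) {q' : ℝ} {I : Type u}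
    {D : ℝ} {M : ℕ} {r : ℝ} {κ : ℝ≥0∞} {α β : I → X →ᵇ ℂ}
    (h : IsHolderPair p.toReal q' D M r κ α β) {b T : BOp X E p}
    (hT : ∀ (v : Ell X E p) (x : X),
      HasSum (fun i => α i x • (b (mulOp (β i) v)).val x) ((T v).val x))
    {R δ D' : ℝ} (hR : 0 ≤ R) (hδ : ∀ S S' : Set X, (∀ x ∈ S, ∀ y ∈ S', R ≤ dist x y) →
      ‖mulOp (ind S) * b * mulOp (ind S')‖ ≤ δ) (hr : D' + R ≤ r) (x₀ : X)
    (v : Ell X E p) (hv : ∀ x, v.val x ≠ 0 → dist x x₀ ≤ D') :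
    ‖(b - T) v‖ₑ ^ p.toReal ≤ 3 ^ p.toReal * (κ * ENNReal.ofReal ‖b‖ ^ p.toReal +
      2 * ENNReal.ofReal δ ^ p.toReal + ENNReal.ofReal ‖b‖ ^ p.toReal * κ) * ‖v‖ₑ ^ p.toReal := by
  have hq := h.conj.pos
  let K : Set X := Metric.closedBall x₀ (D' + R)
  -- `y₂` is small by quasi-locality, and `ψ i` is small where `y₁` and `v` live
  let y₁ : Ell X E p := mulOp (ind K) (b v)
  let y₂ : Ell X E p := mulOp (ind Kᶜ) (b v)
  let ψ : I → X →ᵇ ℂ := fun i => β i - β i x₀ • 1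
  have hψ : ∀ i x, ψ i x = β i x - β i x₀ := fun i x => by simp [ψ]
  have hy12 : b v = y₁ + y₂ := by
    simp only [y₁, y₂]
    rw [← one_sub_ind, mulOp_sub, mulOp_one, sub_apply]
    simp
  have hy1 : ‖y₁‖ₑ ≤ ENNReal.ofReal ‖b‖ * ‖v‖ₑ := by
    have h1 : ‖y₁‖ₑ ≤ ‖b v‖ₑ := by
      rw [← ofReal_norm, ← ofReal_norm]
      exact ENNReal.ofReal_le_ofReal (norm_mulOp_apply_le (norm_ind_le K) (b v))
    exact h1.trans (enorm_apply_le b v)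
  have hy2 : ‖y₂‖ₑ ≤ ENNReal.ofReal δ * ‖v‖ₑ := by
    have h1 : y₂ = (mulOp (ind Kᶜ) * b * mulOp (ind (Metric.closedBall x₀ D')) : BOp X E p) v := by
      have h2 : mulOp (ind (Metric.closedBall x₀ D')) v = v := by
        ext x
        by_cases hx : v.val x = 0
        · rw [mulOp_apply_val, hx, smul_zero]
        · exact mulOp_ind_val_of_mem (Metric.mem_closedBall.2 (hv x hx)) v
      rw [mul_apply_eq_comp, mul_apply_eq_comp, h2]
    rw [h1]
    refine (enorm_apply_le _ _).trans ?_
    gcongr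
    refine hδ _ _ fun x hx y hy => ?_
    rw [Set.mem_compl_iff, Metric.mem_closedBall, not_le] at hx
    rw [Metric.mem_closedBall] at hy
    have := dist_triangle x y x₀
    linarith
  have h1 := h.enorm_rpow_le hp hp' (w := (b - T) v)
    (u := fun i => mulOp (ψ i) y₁ + mulOp (ψ i) y₂ - b (mulOp (ψ i) v)) (fun x => by
      have h2 := ((h.hasSum x).smul_const ((b v).val x)).sub (hT v x)
      rw [sub_apply, Ell.val_sub]
      rw [one_smul] at h2
      convert h2 using 2 with i
      have h3 : mulOp (ψ i) v = mulOp (β i) v - β i x₀ • v := by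
        ext z
        rw [mulOp_apply_val, Ell.val_sub, mulOp_apply_val, Ell.val_smul, hψ, sub_smul]
      rw [← map_add, ← hy12, h3, map_sub, map_smul]
      simp only [Ell.val_sub, Ell.val_smul, mulOp_apply_val, hψ, sub_smul, smul_sub, mul_smul]
      abel)
  refine h1.trans ?_
  have hκ : ∀ x, dist x x₀ ≤ D' + R → ∑' i, ‖ψ i x‖ₑ ^ p.toReal ≤ κ := by
    intro x hx
    simp only [hψ]
    exact h.variation x x₀ (hx.trans hr)
  have hκ2 : ∀ x, ∑' i, ‖ψ i x‖ₑ ^ p.toReal ≤ 2 := by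
    intro x
    simp only [hψ]
    exact h.variation_le_two x x₀
  have e1 : ∑' i, ‖mulOp (ψ i) y₁‖ₑ ^ p.toReal ≤
      κ * (ENNReal.ofReal ‖b‖ ^ p.toReal * ‖v‖ₑ ^ p.toReal) := by
    refine (tsum_enorm_mulOp_rpow_le hp hp' ψ y₁ fun x hx => hκ x ?_).trans ?_
    · by_contra hc
      exact hx (mulOp_ind_val_of_notMem (fun hK => hc (Metric.mem_closedBall.1 hK)) _)
    · rw [← ENNReal.mul_rpow_of_nonneg _ _ hq.le]
      gcongr
  have e2 : ∑' i, ‖mulOp (ψ i) y₂‖ₑ ^ p.toReal ≤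
      2 * (ENNReal.ofReal δ ^ p.toReal * ‖v‖ₑ ^ p.toReal) := by
    refine (tsum_enorm_mulOp_rpow_le hp hp' ψ y₂ fun x _ => hκ2 x).trans ?_
    rw [← ENNReal.mul_rpow_of_nonneg _ _ hq.le]
    gcongr
  have e3 : ∑' i, ‖b (mulOp (ψ i) v)‖ₑ ^ p.toReal ≤
      ENNReal.ofReal ‖b‖ ^ p.toReal * (κ * ‖v‖ₑ ^ p.toReal) := by
    calc ∑' i, ‖b (mulOp (ψ i) v)‖ₑ ^ p.toReal
        ≤ ∑' i, (ENNReal.ofReal ‖b‖ * ‖mulOp (ψ i) v‖ₑ) ^ p.toReal := by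
          gcongr
          exact enorm_apply_le _ _
      _ = ENNReal.ofReal ‖b‖ ^ p.toReal * ∑' i, ‖mulOp (ψ i) v‖ₑ ^ p.toReal := by
          simp only [ENNReal.mul_rpow_of_nonneg _ _ hq.le]
          rw [ENNReal.tsum_mul_left]
      _ ≤ _ := by
          gcongr
          exact tsum_enorm_mulOp_rpow_le hp hp' ψ v fun x hx => hκ x ((hv x hx).trans (by linarith))
  calc ∑' i, ‖mulOp (ψ i) y₁ + mulOp (ψ i) y₂ - b (mulOp (ψ i) v)‖ₑ ^ p.toReal
      ≤ ∑' i, 3 ^ p.toReal * (‖mulOp (ψ i) y₁‖ₑ ^ p.toReal + ‖mulOp (ψ i) y₂‖ₑ ^ p.toReal +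
          ‖b (mulOp (ψ i) v)‖ₑ ^ p.toReal) := by
        refine ENNReal.tsum_le_tsum fun i => le_trans ?_ (add_add_rpow_le hq _ _ _)
        gcongr
        refine enorm_sub_le.trans ?_
        gcongr
        exact enorm_add_le _ _
    _ = 3 ^ p.toReal * (∑' i, ‖mulOp (ψ i) y₁‖ₑ ^ p.toReal + ∑' i, ‖mulOp (ψ i) y₂‖ₑ ^ p.toReal +
          ∑' i, ‖b (mulOp (ψ i) v)‖ₑ ^ p.toReal) := by
        rw [ENNReal.tsum_mul_left, ENNReal.tsum_add, ENNReal.tsum_add]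
    _ ≤ 3 ^ p.toReal * (κ * (ENNReal.ofReal ‖b‖ ^ p.toReal * ‖v‖ₑ ^ p.toReal) +
          2 * (ENNReal.ofReal δ ^ p.toReal * ‖v‖ₑ ^ p.toReal) +
          ENNReal.ofReal ‖b‖ ^ p.toReal * (κ * ‖v‖ₑ ^ p.toReal)) := by gcongr
    _ = _ := by ring

end Estimates

/-! ### Norm localization and the exponents `1 < p < ∞` -/

section Localization

variable {X : Type u} [MetricSpace X] [DiscreteTopology X]

theorem sum_sign_smul_ind {ι : Type*} [Fintype ι] {S : ι → Set X}
    (hS : Pairwise fun i j => Disjoint (S i) (S j)) (σ : ι → Bool) :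
    ∑ j, (if σ j then 1 else -1 : ℂ) • ind (S j) =
      ind {x | ∃ j, σ j = true ∧ x ∈ S j} - ind {x | ∃ j, σ j = false ∧ x ∈ S j} := by
  classical
  ext x
  have hmem : ∀ j, x ∈ S j → ∀ t, σ j = t → x ∈ {x | ∃ j, σ j = t ∧ x ∈ S j} :=
    fun j hj t ht => ⟨j, ht, hj⟩
  rw [BoundedContinuousFunction.coe_sum, Finset.sum_apply, BoundedContinuousFunction.sub_apply]
  by_cases h : ∃ j, x ∈ S j
  · obtain ⟨j, hj⟩ := h
    have huniq : ∀ i, x ∈ S i → i = j := fun i hi => by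
      by_contra hne
      exact Set.disjoint_left.1 (hS hne) hi hj
    rw [Finset.sum_eq_single j]
    · rw [BoundedContinuousFunction.smul_apply, ind_of_mem hj]
      cases hσ : σ j
      · rw [ind_of_notMem, ind_of_mem (hmem j hj false hσ)]
        · simp
        · rintro ⟨i, hi, hxi⟩
          rw [huniq i hxi, hσ] at hi
          exact Bool.false_ne_true hi
      · rw [ind_of_mem (hmem j hj true hσ), ind_of_notMem]
        · simp
        · rintro ⟨i, hi, hxi⟩
          rw [huniq i hxi, hσ] at hi
          exact Bool.false_ne_true hi.symm
    · intro i _ hi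
      rw [BoundedContinuousFunction.smul_apply, ind_of_notMem fun h => hi (huniq i h), smul_zero]
    · simp
  · push Not at h
    have hnot : ∀ t, x ∉ {x | ∃ j, σ j = t ∧ x ∈ S j} := by
      rintro t ⟨j, -, hj⟩
      exact h j hj
    rw [ind_of_notMem (hnot _), ind_of_notMem (hnot _), sub_zero]
    refine Finset.sum_eq_zero fun j _ => ?_
    rw [BoundedContinuousFunction.smul_apply, ind_of_notMem (h j), smul_zero]

theorem ind_exists_eq_add {ι : Type*} {S : ι → Set X}
    (hS : Pairwise fun i j => Disjoint (S i) (S j)) (σ : ι → Bool) :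
    ind {x | ∃ j, x ∈ S j} =
      ind {x | ∃ j, σ j = true ∧ x ∈ S j} + ind {x | ∃ j, σ j = false ∧ x ∈ S j} := by
  ext x
  have hmem : ∀ j, x ∈ S j → ∀ t, σ j = t → x ∈ {x | ∃ j, σ j = t ∧ x ∈ S j} :=
    fun j hj t ht => ⟨j, ht, hj⟩
  rw [BoundedContinuousFunction.add_apply]
  by_cases h : ∃ j, x ∈ S j
  · obtain ⟨j, hj⟩ := h
    have huniq : ∀ i, x ∈ S i → i = j := fun i hi => by
      by_contra hne
      exact Set.disjoint_left.1 (hS hne) hi hj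
    rw [ind_of_mem (show x ∈ {x | ∃ j, x ∈ S j} from ⟨j, hj⟩)]
    cases hσ : σ j
    · rw [ind_of_notMem, ind_of_mem (hmem j hj false hσ), zero_add]
      rintro ⟨i, hi, hxi⟩
      rw [huniq i hxi, hσ] at hi
      exact Bool.false_ne_true hi
    · rw [ind_of_mem (hmem j hj true hσ), ind_of_notMem, add_zero]
      rintro ⟨i, hi, hxi⟩
      rw [huniq i hxi, hσ] at hi
      exact Bool.false_ne_true hi.symm
  · push Not at h
    have hnot : ∀ t, x ∉ {x | ∃ j, σ j = t ∧ x ∈ S j} := by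
      rintro t ⟨j, -, hj⟩
      exact h j hj
    have hnot' : x ∉ {x | ∃ j, x ∈ S j} := by
      rintro ⟨j, hj⟩
      exact h j hj
    rw [ind_of_notMem hnot', ind_of_notMem (hnot _),
      ind_of_notMem (hnot _), add_zero]

variable {E : Type v} [NormedAddCommGroup E] [NormedSpace ℂ E] {p : ℝ≥0∞} [Fact (p = 0 ∨ 1 ≤ p)]

/-- If all compressions of `d` between unions over complementary sets of indices are small, then so is
the off-diagonal part of `d`, independently of the number of blocks: it is an average, over the signs
`σ`, of such compressions. -/
theorem norm_diagonal_sub_le {ι : Type*} [Fintype ι] {S S' : ι → Set X}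
    (hS : Pairwise fun i j => Disjoint (S i) (S j)) (hS' : Pairwise fun i j => Disjoint (S' i) (S' j))
    {d : BOp X E p} {R δ : ℝ} (hδ : ∀ A A' : Set X, (∀ x ∈ A, ∀ y ∈ A', R ≤ dist x y) →
      ‖mulOp (ind A) * d * mulOp (ind A')‖ ≤ δ)
    (hsep : ∀ i j, i ≠ j → ∀ x ∈ S i, ∀ y ∈ S' j, R ≤ dist x y) :
    ‖∑ j, mulOp (ind (S j)) * d * mulOp (ind (S' j)) -
      mulOp (ind {x | ∃ j, x ∈ S j}) * d * mulOp (ind {x | ∃ j, x ∈ S' j})‖ ≤ 4 * δ := by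
  classical
  refine norm_sum_mul_mul_sub_le (fun j => (mulOp (ind (S j)) : BOp X E p))
    (fun j => mulOp (ind (S' j))) d _ fun σ => ?_
  rw [sum_smul_mulOp, sum_smul_mulOp, sum_sign_smul_ind hS, sum_sign_smul_ind hS',
    ind_exists_eq_add hS σ, ind_exists_eq_add hS' σ, mulOp_sub, mulOp_sub, mulOp_add, mulOp_add]
  set P : BOp X E p := mulOp (ind {x | ∃ j, σ j = true ∧ x ∈ S j})
  set P' : BOp X E p := mulOp (ind {x | ∃ j, σ j = false ∧ x ∈ S j})
  set Q : BOp X E p := mulOp (ind {x | ∃ j, σ j = true ∧ x ∈ S' j})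
  set Q' : BOp X E p := mulOp (ind {x | ∃ j, σ j = false ∧ x ∈ S' j})
  have h1 : ‖P * d * Q'‖ ≤ δ := by
    refine hδ _ _ ?_
    rintro x ⟨i, hi, hx⟩ y ⟨j, hj, hy⟩
    refine hsep i j (fun h => ?_) x hx y hy
    rw [h, hj] at hi
    exact Bool.false_ne_true hi
  have h2 : ‖P' * d * Q‖ ≤ δ := by
    refine hδ _ _ ?_
    rintro x ⟨i, hi, hx⟩ y ⟨j, hj, hy⟩
    refine hsep i j (fun h => ?_) x hx y hy
    rw [h, hj] at hi
    exact Bool.false_ne_true hi.symm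
  have h3 : (P - P') * d * (Q - Q') - (P + P') * d * (Q + Q') =
      -((P * d * Q' + P' * d * Q) + (P * d * Q' + P' * d * Q)) := by noncomm_ring
  rw [h3, norm_neg]
  have h4 := norm_add_le (P * d * Q') (P' * d * Q)
  refine (norm_add_le _ _).trans ?_
  linarith

/-- For a block diagonal operator, the `p`-norms of the blocks add up. -/
theorem enorm_sum_blocks_rpow_le (hp : 1 ≤ p) (hp' : p ≠ ∞) {ι : Type*} [Fintype ι]
    {S S' : ι → Set X} (hS : Pairwise fun i j => Disjoint (S i) (S j))
    (hS' : Pairwise fun i j => Disjoint (S' i) (S' j)) {d : BOp X E p} {C : ℝ≥0∞} (v : Ell X E p)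
    (h : ∀ j, ‖d (mulOp (ind (S' j)) v)‖ₑ ^ p.toReal ≤ C * ‖mulOp (ind (S' j)) v‖ₑ ^ p.toReal) :
    ‖(∑ j, mulOp (ind (S j)) * d * mulOp (ind (S' j)) : BOp X E p) v‖ₑ ^ p.toReal ≤
      C * ‖v‖ₑ ^ p.toReal := by
  classical
  have hq : 0 < p.toReal := ENNReal.toReal_pos (zero_lt_one.trans_le hp).ne' hp'
  have h1 : ‖(∑ j, mulOp (ind (S j)) * d * mulOp (ind (S' j)) : BOp X E p) v‖ₑ ^ p.toReal ≤
      ∑ j, ‖d (mulOp (ind (S' j)) v)‖ₑ ^ p.toReal := by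
    simp only [Ell.enorm_rpow_eq_tsum hp hp']
    rw [← Summable.tsum_finsetSum fun _ _ => ENNReal.summable]
    refine ENNReal.tsum_le_tsum fun x => ?_
    have h2 : ((∑ j, mulOp (ind (S j)) * d * mulOp (ind (S' j)) : BOp X E p) v).val x =
        ∑ j, ind (S j) x • (d (mulOp (ind (S' j)) v)).val x := by
      rw [sum_apply, Ell.val_sum]
      rfl
    rw [h2]
    by_cases hx : ∃ j, x ∈ S j
    · obtain ⟨j, hj⟩ := hx
      rw [Finset.sum_eq_single j]
      · rw [ind_of_mem hj, one_smul]
        exact Finset.single_le_sum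
          (f := fun j => ‖(d (mulOp (ind (S' j)) v)).val x‖ₑ ^ p.toReal) (fun _ _ => bot_le)
          (Finset.mem_univ j)
      · intro i _ hi
        rw [ind_of_notMem fun h => Set.disjoint_left.1 (hS hi) h hj, zero_smul]
      · simp
    · push Not at hx
      rw [Finset.sum_eq_zero fun j _ => by rw [ind_of_notMem (hx j), zero_smul], enorm_zero,
        ENNReal.zero_rpow_of_pos hq]
      exact bot_le
  refine h1.trans ((Finset.sum_le_sum fun j _ => h j).trans ?_)
  rw [← Finset.mul_sum]
  gcongr
  have h3 := tsum_enorm_mulOp_rpow_le hp hp' (fun j => ind (S' j)) v (κ := 1) fun x _ => by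
    by_cases hx : ∃ j, x ∈ S' j
    · obtain ⟨j, hj⟩ := hx
      rw [tsum_eq_single j, ind_of_mem hj, enorm_one, ENNReal.one_rpow]
      intro i hi
      rw [ind_of_notMem fun h => Set.disjoint_left.1 (hS' hi) h hj, enorm_zero,
        ENNReal.zero_rpow_of_pos hq]
    · push Not at hx
      simp only [ind_of_notMem (hx _), enorm_zero, ENNReal.zero_rpow_of_pos hq, tsum_zero]
      exact bot_le
  rwa [tsum_fintype, one_mul] at h3

/-- Operator norm localization for quasi-local operators: if `d` has norm at most `η` on vectors
supported in balls of radius `D`, and compressions of norm at most `δ` between sets at distance `R`,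
then `‖d‖ ≤ ‖d‖ γ + 5 δ + η`. A finitely supported vector is replaced, at the cost of the first
term, by one living on separated pieces of diameter at most `D`. -/
theorem IsUnitPartition.norm_le_of_localized (hX : BoundedGeometry X) (hp : 1 ≤ p) (hp' : p ≠ ∞)
    {I : Type u} {D : ℝ} {M : ℕ} {R : ℝ} {ε : ℝ≥0∞} {μ : I → X → ℝ}
    (hμ : IsUnitPartition D M (2 * R) ε μ) {N : ℕ}
    (hN : ∀ x : X, (Metric.closedBall x (2 * R)).encard ≤ N) {γ : ℝ} (hγ : 0 ≤ γ)
    (hc : N * ε < ENNReal.ofReal γ ^ p.toReal)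
    {d : BOp X E p} (hR : 0 < R) {δ : ℝ} (hδ0 : 0 ≤ δ)
    (hδ : ∀ A A' : Set X, (∀ x ∈ A, ∀ y ∈ A', R ≤ dist x y) →
      ‖mulOp (ind A) * d * mulOp (ind A')‖ ≤ δ)
    {η : ℝ} (hη0 : 0 ≤ η) (hη : ∀ (x₀ : X) (v : Ell X E p), (∀ x, v.val x ≠ 0 → dist x x₀ ≤ D) →
      ‖d v‖ₑ ^ p.toReal ≤ ENNReal.ofReal η ^ p.toReal * ‖v‖ₑ ^ p.toReal) :
    ‖d‖ ≤ ‖d‖ * γ + 5 * δ + η := by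
  classical
  have hq : 0 < p.toReal := ENNReal.toReal_pos (zero_lt_one.trans_le hp).ne' hp'
  refine opNorm_le_of_finite_support hp' (by positivity) fun v G hG => ?_
  -- the points of mass zero are removed, as sparsification asks for a positive weight
  let s := G.filter fun x => v.val x ≠ 0
  have hs : ∀ x, x ∉ s → v.val x = 0 := by
    intro x hx
    by_contra h
    exact hx (Finset.mem_filter.2 ⟨by_contra fun hxG => h (hG x hxG), h⟩)
  obtain ⟨P, hP, hPd, hPw⟩ := hμ.exists_sparse hX hN hc
    (ENNReal.rpow_ne_top_of_nonneg hq.le ENNReal.ofReal_ne_top) (fun x => ‖v.val x‖ₑ ^ p.toReal) s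
    (fun x hx => by
      rw [Ne, ENNReal.rpow_eq_zero_iff_of_pos hq, enorm_eq_zero]
      exact (Finset.mem_filter.1 hx).2)
    (fun x _ => ENNReal.rpow_ne_top_of_nonneg hq.le enorm_ne_top)
  -- the pieces `S' j`, and their `R`-neighbourhoods `S j`, which are still disjoint
  let S' : P → Set X := fun j => ((j : Finset X) : Set X)
  let S : P → Set X := fun j => {y | ∃ x ∈ (j : Finset X), dist x y < R}
  have hfar : ∀ i j : P, i ≠ j → ∀ x ∈ (i : Finset X), ∀ y ∈ (j : Finset X), 2 * R < dist x y :=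
    fun i j hij x hx y hy => hPd i i.2 j j.2 (fun h => hij (Subtype.ext h)) x hx y hy
  have hSd : Pairwise fun i j => Disjoint (S i) (S j) := by
    intro i j hij
    refine Set.disjoint_left.2 ?_
    rintro z ⟨x, hx, hxz⟩ ⟨y, hy, hyz⟩
    have h1 := hfar i j hij x hx y hy
    have h2 := dist_triangle_right x y z
    linarith
  have hSd' : Pairwise fun i j => Disjoint (S' i) (S' j) := by
    intro i j hij
    refine Set.disjoint_left.2 fun x hx hy => ?_
    have h1 := hfar i j hij x hx x hy
    rw [dist_self] at h1
    linarith
  have hsep : ∀ i j, i ≠ j → ∀ x ∈ S i, ∀ y ∈ S' j, R ≤ dist x y := by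
    rintro i j hij z ⟨x, hx, hxz⟩ y hy
    have h1 := hfar i j hij x hx y hy
    have h2 := dist_triangle x z y
    linarith
  set Ω : Set X := {x | ∃ j, x ∈ S' j}
  set Y : Set X := {x | ∃ j, x ∈ S j}
  -- the part of `v` outside of the pieces
  have h1 : ‖mulOp (ind Ωᶜ) v‖ ≤ γ * ‖v‖ := by
    refine norm_le_of_enorm_rpow_le hq hγ ?_
    have h2 : ∀ x, x ∉ s \ P.biUnion id → (mulOp (ind Ωᶜ) v).val x = 0 := by
      intro x hx
      by_cases hxs : x ∈ s
      · have hxP : x ∈ P.biUnion id := by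
          by_contra h
          exact hx (Finset.mem_sdiff.2 ⟨hxs, h⟩)
        obtain ⟨A, hA, hxA⟩ := Finset.mem_biUnion.1 hxP
        exact mulOp_ind_val_of_notMem (fun h : x ∈ Ωᶜ => h ⟨⟨A, hA⟩, hxA⟩) v
      · rw [mulOp_apply_val, hs x hxs, smul_zero]
    rw [Ell.enorm_rpow_eq_tsum hp hp' (mulOp (ind Ωᶜ) v), tsum_eq_sum (s := s \ P.biUnion id)
      fun x hx => by rw [h2 x hx, enorm_zero, ENNReal.zero_rpow_of_pos hq]]
    calc ∑ x ∈ s \ P.biUnion id, ‖(mulOp (ind Ωᶜ) v).val x‖ₑ ^ p.toReal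
        ≤ ∑ x ∈ s \ P.biUnion id, ‖v.val x‖ₑ ^ p.toReal := by
          gcongr with x _
          rw [mulOp_apply_val, enorm_smul]
          refine mul_le_of_le_one_left bot_le ?_
          rw [← ofReal_norm, ENNReal.ofReal_le_one]
          exact norm_ind_le _ _
      _ ≤ ENNReal.ofReal γ ^ p.toReal * ∑ x ∈ s, ‖v.val x‖ₑ ^ p.toReal := hPw
      _ ≤ _ := by
          gcongr
          rw [Ell.enorm_rpow_eq_tsum hp hp' v]
          exact ENNReal.sum_le_tsum s
  -- the part of `d v` outside of the neighbourhoods of the pieces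
  have h2 : ‖(mulOp (ind Yᶜ) * d * mulOp (ind Ω) : BOp X E p) v‖ ≤ δ * ‖v‖ := by
    refine ContinuousLinearMap.le_of_opNorm_le _ (hδ _ _ ?_) v
    rintro y hy x ⟨j, hx⟩
    by_contra! h
    rw [dist_comm] at h
    exact hy ⟨j, x, hx, h⟩
  -- between the neighbourhoods and the pieces, `d` is nearly block diagonal
  have h3 := norm_diagonal_sub_le hSd hSd' hδ hsep
  have h4 : ‖(∑ j, mulOp (ind (S j)) * d * mulOp (ind (S' j)) : BOp X E p) v‖ ≤ η * ‖v‖ := by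
    refine norm_le_of_enorm_rpow_le hq hη0 ?_
    refine enorm_sum_blocks_rpow_le hp hp' hSd hSd' v fun j => ?_
    rcases (j : Finset X).eq_empty_or_nonempty with hj | ⟨x₀, hx₀⟩
    · have : mulOp (ind (S' j)) v = 0 := by
        ext x
        refine mulOp_ind_val_of_notMem (fun h => ?_) v
        have h' : x ∈ (j : Finset X) := h
        rw [hj] at h'
        exact Finset.notMem_empty x h'
      have hz : ‖(0 : Ell X E p)‖ₑ = 0 := enorm_zero
      rw [this, map_zero, hz, ENNReal.zero_rpow_of_pos hq]
      exact bot_le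
    · refine hη x₀ _ fun x hx => ?_
      refine (hP j j.2).2 x ?_ x₀ hx₀
      by_contra h
      exact hx (mulOp_ind_val_of_notMem h v)
  have hsplit : d v = d (mulOp (ind Ωᶜ) v) + (mulOp (ind Yᶜ) * d * mulOp (ind Ω) : BOp X E p) v +
      ((∑ j, mulOp (ind (S j)) * d * mulOp (ind (S' j)) : BOp X E p) v -
        (∑ j, mulOp (ind (S j)) * d * mulOp (ind (S' j)) -
          mulOp (ind Y) * d * mulOp (ind Ω) : BOp X E p) v) := by
    have e1 : d = d * mulOp (ind Ωᶜ) + mulOp (ind Yᶜ) * d * mulOp (ind Ω) +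
        (∑ j, mulOp (ind (S j)) * d * mulOp (ind (S' j)) -
        (∑ j, mulOp (ind (S j)) * d * mulOp (ind (S' j)) -
          mulOp (ind Y) * d * mulOp (ind Ω))) := by
      rw [← one_sub_ind, ← one_sub_ind, mulOp_sub, mulOp_sub, mulOp_one]
      noncomm_ring
    exact congrArg (fun a : BOp X E p => a v) e1
  have h5 : ‖d (mulOp (ind Ωᶜ) v)‖ ≤ ‖d‖ * (γ * ‖v‖) := (d.le_opNorm _).trans (by gcongr)
  have h6 := ContinuousLinearMap.le_of_opNorm_le _ h3 v
  have h7 : ‖d v‖ ≤ ‖d‖ * (γ * ‖v‖) + δ * ‖v‖ + (η * ‖v‖ + 4 * δ * ‖v‖) := by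
    rw [hsplit]
    exact (norm_add_le _ _).trans (add_le_add ((norm_add_le _ _).trans (add_le_add h5 h2))
      ((norm_sub_le _ _).trans (add_le_add h4 h6)))
  linarith

variable [CompleteSpace E]

/-- For `1 < p < ∞` and under Property A, a quasi-local operator `b` is approximated by operators of
the form `∑ i, α i b β i`. -/
theorem QuasiLocal.mem_roe_of_propertyA (hX : BoundedGeometry X) (hA : PropertyA X)
    (hp : 1 < p) (hp' : p ≠ ∞) {B : NonUnitalSubalgebra ℂ (BOp X E p)}
    (hB_cb : cbCb (B : Set (BOp X E p)) = B)
    (hB_cut : ClosedUnderBlockCutdowns (B : Set (BOp X E p))) {b : BOp X E p} (hb : b ∈ B)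
    (hql : QuasiLocal b) : b ∈ roe (B : Set (BOp X E p)) := by
  have hq1 : 1 < p.toReal := by
    rw [← ENNReal.toReal_one]
    exact (ENNReal.toReal_lt_toReal ENNReal.one_ne_top hp').2 hp
  have hq : 0 < p.toReal := zero_lt_one.trans hq1
  refine Metric.mem_closure_iff.2 fun ε hε => ?_
  -- the error will be `2 δ + 5 * (2 δ) + 12 δ = 24 δ`, and `γ` is such that `γ ‖b‖ ≤ δ`
  set δ := ε / 50 with hδdef
  have hδ : 0 < δ := by positivity
  set C := ‖b‖ + 1 with hCdef
  have hC : 0 < C := by positivity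
  set γ := δ / C with hγdef
  have hγ : 0 < γ := by positivity
  have hγq : 0 < γ ^ p.toReal := Real.rpow_pos_of_pos hγ _
  obtain ⟨R, hR, hbR⟩ := hql δ hδ
  obtain ⟨N, hN⟩ := hX (2 * R)
  -- `μ` serves the sparsification; `μ₂`, whose scale depends on the pieces found with `μ`, serves to
  -- define the approximation `T`
  obtain ⟨D, M, I, μ, hμ⟩ := hA.exists_isUnitPartition (r := 2 * R) (by positivity)
    (ε := γ ^ p.toReal / (N + 1)) (by positivity)
  obtain ⟨D₂, M₂, I₂, μ₂, hμ₂⟩ := hA.exists_isUnitPartition (r := |D| + R) (by positivity) hγq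
  obtain ⟨q', α, β, h⟩ := hμ₂.exists_isHolderPair hq1
  obtain ⟨T, hTB, hTf, hT⟩ := exists_hasSum_band hX hB_cb hB_cut hb
    (S := fun i => {x | β i x ≠ 0}) (D := D₂) (M := M₂) (α := α) (β := β)
    (fun i x hx y hy => h.dist_le i x y hx hy) h.encard_le h.norm_left_le h.norm_right_le
    (fun i x hx => h.left_eq_zero i x (not_not.1 hx)) (fun i x hx => not_not.1 hx)
  refine ⟨T, ⟨hTB, hTf⟩, ?_⟩
  have hTb : ‖T‖ ≤ ‖b‖ := by
    have := h.norm_compression_le hp.le hp' hT 1 1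
    simpa using this
  have hκ : ENNReal.ofReal (γ ^ p.toReal) = ENNReal.ofReal γ ^ p.toReal :=
    (ENNReal.ofReal_rpow_of_pos hγ).symm
  have hd : ‖b - T‖ ≤ ‖b - T‖ * γ + 5 * (2 * δ) + 12 * δ := by
    refine hμ.norm_le_of_localized hX hp.le hp' hN hγ.le ?_ hR (by positivity) ?_ (by positivity) ?_
    · rw [← hκ, ← ENNReal.ofReal_natCast, ← ENNReal.ofReal_mul (Nat.cast_nonneg N),
        ENNReal.ofReal_lt_ofReal_iff hγq, mul_div_assoc', div_lt_iff₀ (by positivity)]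
      nlinarith
    · intro A A' hAA
      have e1 : mulOp (ind A) * (b - T) * mulOp (ind A') =
          mulOp (ind A) * b * mulOp (ind A') - mulOp (ind A) * T * mulOp (ind A') := by
        noncomm_ring
      have e2 := hbR A A' hAA
      have e3 := (h.norm_compression_le hp.le hp' hT (ind A) (ind A')).trans e2
      rw [e1]
      refine (norm_sub_le _ _).trans ?_
      linarith
    · intro x₀ v hv
      refine (h.enorm_sub_apply_rpow_le hp.le hp' hT hR.le hbR le_rfl x₀ v
        fun x hx => (hv x hx).trans (le_abs_self D)).trans ?_
      gcongr
      have e1 : ENNReal.ofReal γ ^ p.toReal * ENNReal.ofReal ‖b‖ ^ p.toReal ≤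
          ENNReal.ofReal δ ^ p.toReal := by
        rw [← ENNReal.mul_rpow_of_nonneg _ _ hq.le, ← ENNReal.ofReal_mul hγ.le]
        gcongr
        rw [hγdef, div_mul_eq_mul_div, div_le_iff₀ hC]
        gcongr
        linarith
      have e2 : (4 : ℝ≥0∞) ≤ 4 ^ p.toReal := by
        have := ENNReal.rpow_le_rpow_of_exponent_le (x := 4) (by norm_num) hq1.le
        rwa [ENNReal.rpow_one] at this
      have e3 : ENNReal.ofReal (12 * δ) = 3 * (4 * ENNReal.ofReal δ) := by
        rw [ENNReal.ofReal_mul (by norm_num), ← mul_assoc]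
        norm_num
      rw [hκ, e3, ENNReal.mul_rpow_of_nonneg _ _ hq.le, ENNReal.mul_rpow_of_nonneg _ _ hq.le]
      gcongr
      calc _ ≤ ENNReal.ofReal δ ^ p.toReal + 2 * ENNReal.ofReal δ ^ p.toReal +
            ENNReal.ofReal δ ^ p.toReal := by
            rw [mul_comm (ENNReal.ofReal ‖b‖ ^ p.toReal)]
            gcongr
        _ = 4 * ENNReal.ofReal δ ^ p.toReal := by ring
        _ ≤ _ := by gcongr
  have hγd : ‖b - T‖ * γ ≤ 2 * δ := by
    have e1 : ‖b - T‖ ≤ 2 * C := (norm_sub_le _ _).trans (by linarith)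
    calc ‖b - T‖ * γ ≤ 2 * C * γ := by gcongr
      _ = 2 * δ := by rw [hγdef]; field_simp
  rw [dist_eq_norm]
  linarith

/-- Operators in `B` that almost commute with slowly varying functions belong to `Roe(X, B)`. -/
theorem AlmostCommutes.mem_roe (hX : BoundedGeometry X) (hA : 1 < p → p < ∞ → PropertyA X)
    {B : NonUnitalSubalgebra ℂ (BOp X E p)}
    (hB_cb : cbCb (B : Set (BOp X E p)) = B)
    (hB_cut : ClosedUnderBlockCutdowns (B : Set (BOp X E p))) {b : BOp X E p} (hb : b ∈ B)
    (h : AlmostCommutes b) : b ∈ roe (B : Set (BOp X E p)) := by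
  by_cases hsup : p = 0 ∨ p = ∞
  · exact h.quasiLocal.mem_roe_of_sup hX (normExp_eq_top_iff.2 hsup) hB_cb hB_cut hb
  rw [not_or] at hsup
  have hp : 1 ≤ p := (Fact.out : p = 0 ∨ 1 ≤ p).resolve_left hsup.1
  rcases hp.eq_or_lt with hp | hp
  · exact h.quasiLocal.mem_roe_of_eq_one hX hp.symm hB_cb hB_cut hb
  · exact h.quasiLocal.mem_roe_of_propertyA hX (hA hp (lt_top_iff_ne_top.2 hsup.2)) hp hsup.2 hB_cb
      hB_cut hb

end Localization

end RoeLike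

end

theorem proposition5p4 {X : Type u} [MetricSpace X] (hX : RoeLike.BoundedGeometry X)
    {E : Type v} [NormedAddCommGroup E] [NormedSpace ℂ E] [CompleteSpace E]
    (p : ℝ≥0∞) [Fact (p = 0 ∨ 1 ≤ p)]
    (hA : 1 < p → p < ∞ → RoeLike.PropertyA X)
    (B : NonUnitalSubalgebra ℂ (RoeLike.BOp X E p))
    (hB_closed : IsClosed (B : Set (RoeLike.BOp X E p)))
    (hB_cb : RoeLike.cbCb (B : Set (RoeLike.BOp X E p)) = B)
    (hB_cut : RoeLike.ClosedUnderBlockCutdowns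
      (B : Set (RoeLike.BOp X E p))) :
    (∀ a ∈ RoeLike.roe (B : Set (RoeLike.BOp X E p)), ∀ b ∈ B,
      1 - a * b ∈ RoeLike.compactPart (B : Set (RoeLike.BOp X E p)) →
      1 - b * a ∈ RoeLike.compactPart (B : Set (RoeLike.BOp X E p)) →
      b ∈ RoeLike.roe (B : Set (RoeLike.BOp X E p))) ∧
    (RoeLike.InverseClosed (B : Set (RoeLike.BOp X E p)) →
      RoeLike.InverseClosed
        (RoeLike.roe (B : Set (RoeLike.BOp X E p)))) := by
  have := hX.discreteTopology
  have main : ∀ a ∈ RoeLike.roe (B : Set (RoeLike.BOp X E p)), ∀ b ∈ B,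
      1 - a * b ∈ RoeLike.compactPart (B : Set (RoeLike.BOp X E p)) →
      1 - b * a ∈ RoeLike.compactPart (B : Set (RoeLike.BOp X E p)) →
      b ∈ RoeLike.roe (B : Set (RoeLike.BOp X E p)) := fun a ha b hb hab hba =>
    ((RoeLike.almostCommutes_of_mem_roe ha).of_inverse_mod_compact hab hba).mem_roe hX hA hB_cb
      hB_cut hb
  refine ⟨main, fun hinv a ha => ?_⟩
  have haB : (a : RoeLike.BOp X E p) ∈ B :=
    closure_minimal (fun _ h => h.1) hB_closed ha
  have h0 : (0 : RoeLike.BOp X E p) ∈ RoeLike.compactPart (B : Set (RoeLike.BOp X E p)) :=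
    subset_closure ⟨0, 0, 0, B.zero_mem, by rw [mul_zero, zero_mul]⟩
  refine main a ha _ (hinv a haB) ?_ ?_
  · rwa [Units.mul_inv, sub_self]
  · rwa [Units.inv_mul, sub_self]
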